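/- A labelled plane tree with $n$ edges is a rooted ordered tree whose vertices are labelled bijectively by $\{1,\dots,n+1\}$; it is tip-augmented if the leftmost child of every interior vertex is a leaf. A (non-root) leaf is a \emph{singleton} leaf if it has no siblings; an \emph{elder twin} (respectively \emph{elder non-twin}) leaf if it is the leftmost child of its parent and the second child of that parent exists and is (respectively is not) a leaf; a \emph{second} leaf if it is the second child of its parent; and a \emph{younger} leaf if it is neither the first nor the second child of its parent. A match is a rooted tree with two vertices. Consider sets $F$ of $n$ matches in which each of the labels $1,\dots,n+1,(n+2)^*,\dots,(2n)^*$ occurs exactly once; starred labels are called marked. Chen's merging algorithm starts from $F$ and repeats the following step until a single tree is left: let $T$ be the tree with the smallest root $i$ among the trees without marked vertices, let $j^*$ be the smallest marked vertex and $T^*$ the tree containing it; if $j^*$ is the root of $T^*$, identify $j^*$ with $i$, keep the label $i$ and put the subtrees of $T^*$ to the right of those of $T$ (horizontal merge); if $j^*$ is a leaf of $T^*$, replace $j^*$ in $T^*$ by $T$ (vertical merge). If the result is the tree $T_0$, then $F$ is called a decomposition of $T_0$ into matches. A match is of type i if both its vertices are unmarked, of type iii if its root is unmarked and its leaf is marked,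 and of type iv if both its vertices are marked. \textbf{Theorem.} Let $n\ge 2$. (1) Every labelled tip-augmented plane tree $T$ with $n$ edges has exactly one decomposition $F$ into matches. It contains no match of type iii. A label $x$ is the label of an elder non-twin leaf of $T$ if and only if, in some step of the merging algorithm for $F$, the chosen unmarked tree is a type i match of $F$ with leaf $x$ and it is merged horizontally at a marked vertex that is the root of a type iv match of $F$. A label $x$ is the label of a singleton leaf of $T$ if and only if, in some step, the chosen unmarked tree is a type i match of $F$ with leaf $x$ and it is merged vertically at a marked vertex that is the leaf of a type iv match of $F$. (2) There is an involution $\Psi$ on the set of labelled tip-augmented plane trees with $n$ edges such that, if $F$ is the decomposition of $T$, then $\Psi(T)$ is the tree (and the only tree) obtained by applying the merging algorithm to the set of matches that arises from $F$ by turning every type iv match upside down. For every $T$, the labels of the singleton leaves of $\Psi(T)$ are exactly the labels of the elder non-twin leaves of $T$, the labels of the elder non-twin leaves of $\Psi(T)$ are exactly the labels of the singleton leaves of $T$, and $T$ and $\Psi(T)$ have the same labels of elder twin leaves, the same labels of second leaves, and the same labels of younger leaves. -/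

import Mathlib

/-- Plane (rooted ordered) trees with vertices labelled by natural numbers; the children of a
vertex are listed from left to right. -/
inductive PlaneTree : Type
  | node (label : ℕ) (children : List PlaneTree) : PlaneTree

namespace PlaneTree

/-- The label of the root. -/
def root : PlaneTree → ℕ
  | node a _ => a

/-- The subtrees hanging from the root, from left to right. -/
def children : PlaneTree → List PlaneTree
  | node _ cs => cs

mutual
  /-- All labels of a tree (with repetitions), in preorder. -/
  def labels : PlaneTree → List ℕ
    | node a cs => a :: labelsList cs
  /-- All labels of a list of trees, in preorder. -/
  def labelsList : List PlaneTree → List ℕ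
    | [] => []
    | t :: ts => labels t ++ labelsList ts
end

mutual
  /-- `replace j T U`: the tree `U` with the vertex labelled `j` replaced by the tree `T`. -/
  def replace (j : ℕ) (T : PlaneTree) : PlaneTree → PlaneTree
    | node a cs => if a = j then T else node a (replaceList j T cs)
  /-- `replace` applied to every tree of a list. -/
  def replaceList (j : ℕ) (T : PlaneTree) : List PlaneTree → List PlaneTree
    | [] => []
    | t :: ts => replace j T t :: replaceList j T ts
end

/-- `IsSubtree s T`: `s` is the full subtree of `T` rooted at some vertex of `T`. So
`IsSubtree (node p cs) T` says that `p` is a vertex of `T` and `cs` lists its subtrees. -/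
inductive IsSubtree : PlaneTree → PlaneTree → Prop
  | refl (T : PlaneTree) : IsSubtree T T
  | child (s t : PlaneTree) (a : ℕ) (cs : List PlaneTree) :
      t ∈ cs → IsSubtree s t → IsSubtree s (node a cs)

/-- The vertices of `T` are labelled bijectively by `{1, …, n + 1}` (so `T` has `n` edges). -/
def IsLabelled (n : ℕ) (T : PlaneTree) : Prop :=
  (T.labels : Multiset ℕ) = (Finset.Icc 1 (n + 1)).val

/-- Tip-augmented: the leftmost child of every interior vertex is a leaf. -/
def IsTipAugmented (T : PlaneTree) : Prop :=
  ∀ (p : ℕ) (s : PlaneTree) (cs : List PlaneTree),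
    IsSubtree (node p (s :: cs)) T → s.children = []

/-! ### The five kinds of leaves, as sets of labels -/

/-- Leaves without siblings. -/
def singletonLeaves (T : PlaneTree) : Set ℕ :=
  {x | ∃ p, IsSubtree (node p [node x []]) T}

/-- Leaves that are the leftmost child, where the second child is also a leaf. -/
def elderTwinLeaves (T : PlaneTree) : Set ℕ :=
  {x | ∃ p s cs, IsSubtree (node p (node x [] :: s :: cs)) T ∧ s.children = []}

/-- Leaves that are the leftmost child, where the second child exists and is not a leaf. -/
def elderNonTwinLeaves (T : PlaneTree) : Set ℕ :=
  {x | ∃ p s cs, IsSubtree (node p (node x [] :: s :: cs)) T ∧ s.children ≠ []}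

/-- Leaves that are the second child of their parent. -/
def secondLeaves (T : PlaneTree) : Set ℕ :=
  {x | ∃ p s cs, IsSubtree (node p (s :: node x [] :: cs)) T}

/-- Leaves that are neither the first nor the second child of their parent. -/
def youngerLeaves (T : PlaneTree) : Set ℕ :=
  {x | ∃ p s₁ s₂ cs, IsSubtree (node p (s₁ :: s₂ :: cs)) T ∧ node x [] ∈ cs}

end PlaneTree

/-- Labelled tip-augmented plane trees with `n` edges, on `{1, …, n + 1}`. -/
def TipAugmentedTree (n : ℕ) : Type :=
  {T : PlaneTree // T.IsLabelled n ∧ T.IsTipAugmented}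

/-! ### Matches

A match is a pair `(r, l)`: the rooted tree with root `r` and a single leaf `l`. The labels are
`1, …, n + 1, (n + 2)*, …, (2n)*`; the starred label `k*` is represented by the number `k`, so that
a label is marked exactly when it exceeds `n + 1`. -/

namespace Chen

/-- The label `a` carries a mark. -/
abbrev Marked (n a : ℕ) : Prop := n + 1 < a

/-- A set of matches in which each of `1, …, n + 1, (n + 2)*, …, (2n)*` occurs exactly once. -/
def IsMatchSet (n : ℕ) (F : Finset (ℕ × ℕ)) : Prop :=
  ∑ m ∈ F, ({m.1, m.2} : Multiset ℕ) = (Finset.Icc 1 (2 * n)).val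

/-- Both vertices unmarked. -/
abbrev TypeI (n : ℕ) (m : ℕ × ℕ) : Prop := ¬ Marked n m.1 ∧ ¬ Marked n m.2

/-- Unmarked root, marked leaf. -/
abbrev TypeIII (n : ℕ) (m : ℕ × ℕ) : Prop := ¬ Marked n m.1 ∧ Marked n m.2

/-- Both vertices marked. -/
abbrev TypeIV (n : ℕ) (m : ℕ × ℕ) : Prop := Marked n m.1 ∧ Marked n m.2

/-- Turn all matches with two marked vertices upside down and keep the others. -/
def flip (n : ℕ) (F : Finset (ℕ × ℕ)) : Finset (ℕ × ℕ) :=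
  F.image fun m => if TypeIV n m then (m.2, m.1) else m

/-- A match as a tree. -/
def matchTree (m : ℕ × ℕ) : PlaneTree := .node m.1 [.node m.2 []]

/-- The matches of `F` as a set of trees. -/
def initial (F : Finset (ℕ × ℕ)) : Set PlaneTree := {T | ∃ m ∈ F, T = matchTree m}

/-- No vertex of `T` is marked. -/
def Unmarked (n : ℕ) (T : PlaneTree) : Prop := ∀ a ∈ T.labels, ¬ Marked n a

/-- The choices made in one round of the merging algorithm on the set `S` of trees: `T` is the tree
with the smallest root among the trees without marked vertices, `j` is the smallest marked vertex
of all trees and `U` is the tree containing `j`. -/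
def Selects (n : ℕ) (S : Set PlaneTree) (T U : PlaneTree) (j : ℕ) : Prop :=
  (T ∈ S ∧ Unmarked n T ∧ ∀ T' ∈ S, Unmarked n T' → T.root ≤ T'.root) ∧
  (U ∈ S ∧ j ∈ U.labels ∧ Marked n j ∧ ∀ V ∈ S, ∀ k ∈ V.labels, Marked n k → j ≤ k)

/-- One round of the merging algorithm. -/
inductive Step (n : ℕ) : Set PlaneTree → Set PlaneTree → Prop
  /-- `j` is the root of `U`: it is identified with the root of `T`, whose label is kept, and the
  subtrees of `U` are put to the right of those of `T`. -/
  | horizontal (S : Set PlaneTree) (T U : PlaneTree) (j : ℕ) :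
      Selects n S T U j → U.root = j →
      Step n S (insert (.node T.root (T.children ++ U.children)) (S \ {T, U}))
  /-- `j` is a leaf of `U`: it is replaced by `T`. -/
  | vertical (S : Set PlaneTree) (T U : PlaneTree) (j : ℕ) :
      Selects n S T U j → U.root ≠ j → PlaneTree.IsSubtree (.node j []) U →
      Step n S (insert (PlaneTree.replace j T U) (S \ {T, U}))

/-- `S` occurs in the course of the merging algorithm started from the matches of `F`. -/
def Reaches (n : ℕ) (F : Finset (ℕ × ℕ)) (S : Set PlaneTree) : Prop :=
  Relation.ReflTransGen (Step n) (initial F) S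

/-- `F` is a set of matches on `1, …, n + 1, (n + 2)*, …, (2n)*` that the merging algorithm turns
into the single tree `T`; that is, `F` is the decomposition of `T` into matches. -/
def Decomposes (n : ℕ) (T : PlaneTree) (F : Finset (ℕ × ℕ)) : Prop :=
  IsMatchSet n F ∧ Reaches n F {T}

/-- In the merging algorithm for `F`, some round merges the match `(i, x)` of type i horizontally:
the smallest marked vertex `j` is the root of its tree and the root of a match `(j, l)` of
type iv. -/
def HorizontalMergeIV (n : ℕ) (F : Finset (ℕ × ℕ)) (x : ℕ) : Prop :=
  ∃ (S : Set PlaneTree) (U : PlaneTree) (i j l : ℕ),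
    Reaches n F S ∧ Selects n S (matchTree (i, x)) U j ∧ (i, x) ∈ F ∧ TypeI n (i, x) ∧
    (j, l) ∈ F ∧ TypeIV n (j, l) ∧ U.root = j

/-- In the merging algorithm for `F`, some round merges the match `(i, x)` of type i vertically:
the smallest marked vertex `j` is a leaf of its tree and the leaf of a match `(r, j)` of
type iv. -/
def VerticalMergeIV (n : ℕ) (F : Finset (ℕ × ℕ)) (x : ℕ) : Prop :=
  ∃ (S : Set PlaneTree) (U : PlaneTree) (i j r : ℕ),
    Reaches n F S ∧ Selects n S (matchTree (i, x)) U j ∧ (i, x) ∈ F ∧ TypeI n (i, x) ∧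
    (r, j) ∈ F ∧ TypeIV n (r, j) ∧ U.root ≠ j ∧ PlaneTree.IsSubtree (.node j []) U

end Chen

/-!
The argument describes a run of the merging algorithm by substitution. The mark `j` is merged in its
own round, and in that round it becomes a vertex with the label `fill n F j`, the root of the
selected unmarked tree. Marked vertices are always leaves, or roots with a single child
(`IsState`). Hence the edges of the final tree are the matches of `F` with every mark `a` replaced
by `fill n F a`: a match with unmarked root `p` gives the first edge below `p`, and a match with
marked root `a` gives the edge whose position counts the earlier marks filled with the same label
(`edgeIn_state_iff`).

Uniqueness of the decomposition: if `F` and `F'` give the same tree, their runs fill all marks with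
the same labels. Indeed, once the runs agree before the round `j`, the numbers of children in the
final tree show which subtrees are complete, and this forces both runs to have the same smallest
unmarked root (`fill_le_fill`). The filling and the tree together determine the matches
(`Decomposes.unique`). Existence follows by counting: the map from sets of matches to labelled plane
trees is injective, and there are at most `catalan n * (n + 1)! = (2 * n)! / n!` such trees and at
least `(2 * n)! / n!` sets of matches (`exists_decomposes`).

Unmarked leaves of matches stay leaves, and marked ones become interior vertices. So the tree is
tip-augmented exactly when there is no match of type iii, and in this case the kind of a leaf is
read off from the type of its match and from the rounds in which a root is selected for the first
time, that is, in which the selected tree is a match of type i (`mem_singletonLeaves_iff_fill` and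
its companions).

Finally, turning the matches of type iv upside down does not change these rounds. A root that was
selected before is smaller than every root still waiting for its first selection, as the latter was
available all the time. Therefore a first selection happens exactly when no tree that was selected
before is available, and it takes the smallest waiting root. The number of unmarked trees develops
in the same way in both runs, since a round leaves an unmarked tree behind exactly when the match
of its mark has no other mark left (`FlipRel.sameFresh`). Merging at the root and merging at the
leaf of a match of type iv are interchanged, which swaps elder non-twin and singleton leaves and
fixes the other kinds (`leaves_flip`).
-/

/-! ### Plane trees: induction, subtrees and edges -/

namespace PlaneTree

theorem induction_children {P : PlaneTree → Prop}
    (h : ∀ a cs, (∀ t ∈ cs, P t) → P (node a cs)) (T : PlaneTree) : P T :=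
  PlaneTree.rec (motive_1 := P) (motive_2 := fun l => ∀ t ∈ l, P t) (fun a cs ih => h a cs ih)
    (by simp) (fun t ts h₁ h₂ => by simpa using ⟨h₁, h₂⟩) T

theorem labelsList_eq (cs : List PlaneTree) : labelsList cs = cs.flatMap labels := by
  induction cs with
  | nil => rfl
  | cons t ts ih => simp [labelsList, ih]

theorem labels_node (a : ℕ) (cs : List PlaneTree) :
    (node a cs).labels = a :: cs.flatMap labels := by
  simp [labels, labelsList_eq]

theorem replaceList_eq (j : ℕ) (T : PlaneTree) (cs : List PlaneTree) :
    replaceList j T cs = cs.map (replace j T) := by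
  induction cs with
  | nil => rfl
  | cons t ts ih => simp [replaceList, ih]

theorem replace_node (j : ℕ) (T : PlaneTree) (a : ℕ) (cs : List PlaneTree) :
    replace j T (node a cs) = if a = j then T else node a (cs.map (replace j T)) := by
  simp [replace, replaceList_eq]

@[simp] theorem root_node (a : ℕ) (cs : List PlaneTree) : (node a cs).root = a := rfl

@[simp] theorem children_node (a : ℕ) (cs : List PlaneTree) : (node a cs).children = cs := rfl

theorem node_root_children (T : PlaneTree) : node T.root T.children = T := by
  cases T; rfl

theorem root_mem_labels (T : PlaneTree) : T.root ∈ T.labels := by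
  cases T; simp [labels_node]

theorem isSubtree_node {s : PlaneTree} {a : ℕ} {cs : List PlaneTree} :
    IsSubtree s (node a cs) ↔ s = node a cs ∨ ∃ t ∈ cs, IsSubtree s t := by
  constructor
  · intro h
    cases h with
    | refl => exact Or.inl rfl
    | child t _ _ ht hs => exact Or.inr ⟨t, ht, hs⟩
  · rintro (rfl | ⟨t, ht, hs⟩)
    · exact .refl _
    · exact .child s t a cs ht hs

theorem isSubtree_root (T : PlaneTree) : IsSubtree (node T.root T.children) T := by
  rw [node_root_children]; exact .refl T

theorem IsSubtree.labels_subset {s T : PlaneTree} (h : IsSubtree s T) : s.labels ⊆ T.labels := by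
  induction h with
  | refl => exact List.Subset.refl _
  | child t a cs ht _ ih =>
    intro x hx
    simp only [labels_node, List.mem_cons, List.mem_flatMap]
    exact Or.inr ⟨t, ht, ih hx⟩

theorem IsSubtree.root_mem {p : ℕ} {cs : List PlaneTree} {T : PlaneTree}
    (h : IsSubtree (node p cs) T) : p ∈ T.labels :=
  h.labels_subset (root_mem_labels _)

theorem exists_isSubtree_of_mem_labels {x : ℕ} {T : PlaneTree} (h : x ∈ T.labels) :
    ∃ cs, IsSubtree (node x cs) T := by
  induction T using induction_children with
  | h a cs ih =>
    simp only [labels_node, List.mem_cons, List.mem_flatMap] at h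
    rcases h with rfl | ⟨t, ht, hx⟩
    · exact ⟨cs, .refl _⟩
    · obtain ⟨ds, hds⟩ := ih t ht hx
      exact ⟨ds, .child _ t _ _ ht hds⟩

theorem nodup_of_mem {a : ℕ} {cs : List PlaneTree} {t : PlaneTree}
    (h : (node a cs).labels.Nodup) (ht : t ∈ cs) : t.labels.Nodup := by
  rw [labels_node, List.nodup_cons, List.nodup_flatMap] at h
  exact h.2.1 t ht

theorem eq_of_nodup_flatMap {cs : List PlaneTree} (h : (cs.flatMap labels).Nodup) {s t : PlaneTree}
    (hs : s ∈ cs) (ht : t ∈ cs) {x : ℕ} (hxs : x ∈ s.labels) (hxt : x ∈ t.labels) : s = t := by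
  by_contra hne
  rw [List.nodup_flatMap] at h
  have : Std.Symm (Function.onFun List.Disjoint labels) := ⟨fun _ _ h => h.symm⟩
  exact h.2.forall hs ht hne hxs hxt

theorem IsSubtree.children_unique {T : PlaneTree} (h : T.labels.Nodup) {p : ℕ}
    {cs ds : List PlaneTree} (h₁ : IsSubtree (node p cs) T) (h₂ : IsSubtree (node p ds) T) :
    cs = ds := by
  induction T using induction_children with
  | h a es ih =>
    have hn := h
    rw [labels_node, List.nodup_cons] at hn
    rw [isSubtree_node] at h₁ h₂
    have key : ∀ t ∈ es, ∀ fs, IsSubtree (node a fs) t → False := fun t ht fs hfs =>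
      hn.1 (List.mem_flatMap.2 ⟨t, ht, hfs.root_mem⟩)
    rcases h₁ with h₁ | ⟨t, ht, h₁⟩ <;> rcases h₂ with h₂ | ⟨u, hu, h₂⟩
    · cases h₁; cases h₂; rfl
    · cases h₁; exact (key u hu _ h₂).elim
    · cases h₂; exact (key t ht _ h₁).elim
    · obtain rfl := eq_of_nodup_flatMap hn.2 ht hu h₁.root_mem h₂.root_mem
      exact ih t ht (nodup_of_mem h ht) h₁ h₂

/-- `Edge T p k c`: the vertex `p` of `T` has at least `k + 1` children, and the child with index
`k` (counted from `0`, from left to right) has the label `c`. -/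
def Edge (T : PlaneTree) (p k c : ℕ) : Prop :=
  ∃ cs t, IsSubtree (node p cs) T ∧ cs[k]? = some t ∧ t.root = c

theorem edge_node {a : ℕ} {cs : List PlaneTree} {p k c : ℕ} :
    Edge (node a cs) p k c ↔
      (p = a ∧ ∃ t, cs[k]? = some t ∧ t.root = c) ∨ ∃ t ∈ cs, Edge t p k c := by
  simp only [Edge, isSubtree_node, node.injEq]
  constructor
  · rintro ⟨ds, t, ⟨rfl, rfl⟩ | ⟨u, hu, hs⟩, ht, rfl⟩
    · exact Or.inl ⟨rfl, t, ht, rfl⟩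
    · exact Or.inr ⟨u, hu, ds, t, hs, ht, rfl⟩
  · rintro (⟨rfl, t, ht, rfl⟩ | ⟨u, hu, ds, t, hs, ht, rfl⟩)
    · exact ⟨cs, t, Or.inl ⟨rfl, rfl⟩, ht, rfl⟩
    · exact ⟨ds, t, Or.inr ⟨u, hu, hs⟩, ht, rfl⟩

theorem Edge.left_mem {T : PlaneTree} {p k c : ℕ} (h : Edge T p k c) : p ∈ T.labels := by
  obtain ⟨cs, t, hs, -, -⟩ := h
  exact hs.root_mem

theorem Edge.right_mem {T : PlaneTree} {p k c : ℕ} (h : Edge T p k c) : c ∈ T.labels := by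
  obtain ⟨cs, t, hs, ht, rfl⟩ := h
  refine hs.labels_subset ?_
  simp only [labels_node, List.mem_cons, List.mem_flatMap]
  exact Or.inr ⟨t, List.mem_of_getElem? ht, root_mem_labels t⟩

theorem IsSubtree.edge_iff {T : PlaneTree} (h : T.labels.Nodup) {p : ℕ} {cs : List PlaneTree}
    (hs : IsSubtree (node p cs) T) {k c : ℕ} :
    Edge T p k c ↔ ∃ t, cs[k]? = some t ∧ t.root = c := by
  constructor
  · rintro ⟨ds, t, hd, ht⟩
    obtain rfl := hs.children_unique h hd
    exact ⟨t, ht⟩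
  · rintro ⟨t, ht⟩
    exact ⟨cs, t, hs, ht⟩

theorem IsSubtree.exists_edge_iff {T : PlaneTree} (h : T.labels.Nodup) {p : ℕ}
    {cs : List PlaneTree} (hs : IsSubtree (node p cs) T) {k : ℕ} :
    (∃ c, Edge T p k c) ↔ k < cs.length := by
  simp only [hs.edge_iff h]
  constructor
  · rintro ⟨c, t, ht, -⟩
    exact (List.getElem?_eq_some_iff.1 ht).1
  · intro hk
    exact ⟨_, cs[k], List.getElem?_eq_getElem hk, rfl⟩

theorem Edge.unique {T : PlaneTree} (h : T.labels.Nodup) {p k c d : ℕ} (h₁ : Edge T p k c)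
    (h₂ : Edge T p k d) : c = d := by
  obtain ⟨cs, t, hs, ht, rfl⟩ := h₁
  obtain ⟨u, hu, rfl⟩ := (hs.edge_iff h).1 h₂
  rw [ht] at hu
  cases hu; rfl

theorem not_edge_root {T : PlaneTree} (h : T.labels.Nodup) {p k : ℕ} : ¬ Edge T p k T.root := by
  cases T with
  | node a cs =>
    rw [labels_node, List.nodup_cons, List.mem_flatMap] at h
    intro he
    rcases edge_node.1 he with ⟨rfl, t, ht, hr⟩ | ⟨t, ht, he⟩
    · exact h.1 ⟨t, List.mem_of_getElem? ht, by
        have := root_mem_labels t; rwa [hr] at this⟩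
    · exact h.1 ⟨t, ht, he.right_mem⟩

/-- A property that holds at the root and is inherited by children holds at all vertices. -/
theorem edge_induction {T : PlaneTree} {P : ℕ → Prop} (h₀ : P T.root)
    (h₁ : ∀ p k c, Edge T p k c → P p → P c) : ∀ x ∈ T.labels, P x := by
  induction T using induction_children with
  | h a cs ih =>
    intro x hx
    simp only [labels_node, List.mem_cons, List.mem_flatMap] at hx
    rcases hx with rfl | ⟨t, ht, hx⟩
    · exact h₀
    · obtain ⟨k, hk⟩ := List.mem_iff_getElem?.1 ht
      exact ih t ht (h₁ a k _ (edge_node.2 (Or.inl ⟨rfl, t, hk, rfl⟩)) h₀)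
        (fun p k c he => h₁ p k c (edge_node.2 (Or.inr ⟨t, ht, he⟩))) x hx

theorem eq_root_or_exists_edge {T : PlaneTree} {x : ℕ} (hx : x ∈ T.labels) :
    x = T.root ∨ ∃ p k, Edge T p k x :=
  edge_induction (P := fun x => x = T.root ∨ ∃ p k, Edge T p k x) (Or.inl rfl)
    (fun p k _ he _ => Or.inr ⟨p, k, he⟩) x hx

/-! ### Replacing a leaf by a tree -/

theorem replace_of_notMem {j : ℕ} {T U : PlaneTree} (h : j ∉ U.labels) : replace j T U = U := by
  induction U using induction_children with
  | h a cs ih =>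
    simp only [labels_node, List.mem_cons, List.mem_flatMap, not_or, not_exists, not_and] at h
    rw [replace_node, if_neg (fun e => h.1 e.symm)]
    congr 1
    conv_rhs => rw [← List.map_id cs]
    exact List.map_congr_left fun t ht => ih t ht (h.2 t ht)

theorem root_replace (j : ℕ) (T U : PlaneTree) :
    (replace j T U).root = if U.root = j then T.root else U.root := by
  cases U with
  | node a cs =>
    rw [replace_node]
    split_ifs <;> simp_all

theorem edge_replace {j : ℕ} {T U : PlaneTree} (h : ∀ cs, IsSubtree (node j cs) U → cs = [])
    {p k c : ℕ} :
    Edge (replace j T U) p k c ↔ (j ∈ U.labels ∧ Edge T p k c) ∨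
      ∃ d, Edge U p k d ∧ c = if d = j then T.root else d := by
  induction U using induction_children with
  | h a cs ih =>
    rw [replace_node]
    split_ifs with haj
    · subst haj
      obtain rfl := h cs (.refl _)
      simp [edge_node, labels_node]
    · have ih' : ∀ t ∈ cs, (Edge (replace j T t) p k c ↔ (j ∈ t.labels ∧ Edge T p k c) ∨
          ∃ d, Edge t p k d ∧ c = if d = j then T.root else d) := fun t ht =>
        ih t ht fun ds hds => h ds (.child _ t _ _ ht hds)
      simp only [edge_node, labels_node, List.mem_cons, List.mem_flatMap, List.mem_map,
        List.getElem?_map, Option.map_eq_some_iff, exists_exists_and_eq_and]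
      constructor
      · rintro (⟨rfl, t, ht, rfl⟩ | ⟨t, ht, he⟩)
        · exact Or.inr ⟨t.root, Or.inl ⟨rfl, t, ht, rfl⟩, root_replace j T t⟩
        · rcases (ih' t ht).1 he with ⟨h₁, h₂⟩ | ⟨d, hd, rfl⟩
          · exact Or.inl ⟨Or.inr ⟨t, ht, h₁⟩, h₂⟩
          · exact Or.inr ⟨d, Or.inr ⟨t, ht, hd⟩, rfl⟩
      · rintro (⟨h₁ | ⟨t, ht, h₁⟩, h₂⟩ | ⟨d, ⟨rfl, t, ht, rfl⟩ | ⟨t, ht, hd⟩, rfl⟩)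
        · exact (haj h₁.symm).elim
        · exact Or.inr ⟨t, ht, (ih' t ht).2 (Or.inl ⟨h₁, h₂⟩)⟩
        · exact Or.inl ⟨rfl, t, ht, root_replace j T t⟩
        · exact Or.inr ⟨t, ht, (ih' t ht).2 (Or.inr ⟨d, hd, rfl⟩)⟩

theorem isSubtree_replace {j a : ℕ} {T U : PlaneTree} {cs : List PlaneTree}
    (h : IsSubtree (node a cs) (replace j T U)) :
    IsSubtree (node a cs) T ∨
      ∃ ds, IsSubtree (node a ds) U ∧ cs = ds.map (replace j T) ∧ a ≠ j := by
  induction U using induction_children with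
  | h b es ih =>
    rw [replace_node] at h
    split_ifs at h with hb
    · exact Or.inl h
    · rcases isSubtree_node.1 h with h | ⟨t, ht, h⟩
      · cases h
        exact Or.inr ⟨es, .refl _, rfl, hb⟩
      · obtain ⟨u, hu, rfl⟩ := List.mem_map.1 ht
        rcases ih u hu h with h | ⟨ds, h₁, h₂⟩
        · exact Or.inl h
        · exact Or.inr ⟨ds, .child _ u _ _ hu h₁, h₂⟩

theorem labels_replace {j : ℕ} {T U : PlaneTree} (hU : U.labels.Nodup)
    (h : IsSubtree (node j []) U) :
    ((replace j T U).labels : Multiset ℕ) + {j} =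
      (T.labels : Multiset ℕ) + (U.labels : Multiset ℕ) := by
  induction U using induction_children with
  | h a cs ih =>
    rw [replace_node]
    split_ifs with haj
    · subst haj
      obtain rfl := h.children_unique hU (.refl _)
      simp [labels_node]
    · rcases isSubtree_node.1 h with h | ⟨t, ht, hs⟩
      · cases h; exact (haj rfl).elim
      · have iht := ih t ht (nodup_of_mem hU ht) hs
        have hn := hU
        rw [labels_node, List.nodup_cons] at hn
        obtain ⟨l₁, l₂, rfl⟩ := List.append_of_mem ht
        have hrest : ∀ u ∈ l₁ ++ l₂, replace j T u = u := by
          intro u hu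
          apply replace_of_notMem
          intro hju
          rw [List.flatMap_append, List.flatMap_cons] at hn
          have hn2 := hn.2
          rw [List.nodup_append, List.nodup_append] at hn2
          rcases List.mem_append.1 hu with hu | hu
          · exact hn2.2.2 j (List.mem_flatMap.2 ⟨u, hu, hju⟩) j
              (List.mem_append.2 (Or.inl hs.root_mem)) rfl
          · exact hn2.2.1.2.2 j hs.root_mem j (List.mem_flatMap.2 ⟨u, hu, hju⟩) rfl
        have e₁ : l₁.map (replace j T) = l₁ := by
          conv_rhs => rw [← List.map_id l₁]
          exact List.map_congr_left fun u hu => hrest u (by simp [hu])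
        have e₂ : l₂.map (replace j T) = l₂ := by
          conv_rhs => rw [← List.map_id l₂]
          exact List.map_congr_left fun u hu => hrest u (by simp [hu])
        rw [List.map_append, List.map_cons, e₁, e₂, labels_node, labels_node]
        simp only [List.flatMap_append, List.flatMap_cons, ← Multiset.cons_coe,
          ← Multiset.coe_add, ← Multiset.singleton_add]
        calc _ = {a} + (l₁.flatMap labels : Multiset ℕ) + (l₂.flatMap labels : Multiset ℕ) +
              (((replace j T t).labels : Multiset ℕ) + {j}) := by abel
          _ = _ := by rw [iht]; abel

end PlaneTree

/-! ### Counting labelled plane trees and sets of matches -/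

namespace PlaneTree

mutual
  /-- The binary tree with the shape of `T :: ts`, where `r` is the shape of `ts`; see
  `forestShape`. -/
  def shapeAux : PlaneTree → BinaryTree Unit → BinaryTree Unit
    | node _ cs, r => .node () (forestShape cs) r
  /-- The binary tree that encodes the shape of an ordered forest: left child stands for first
  child, right child stands for next sibling. -/
  def forestShape : List PlaneTree → BinaryTree Unit
    | [] => .nil
    | t :: ts => shapeAux t (forestShape ts)
end

theorem forestShape_cons (a : ℕ) (cs ts : List PlaneTree) :
    forestShape (node a cs :: ts) = .node () (forestShape cs) (forestShape ts) := by
  simp [forestShape, shapeAux]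

theorem numNodes_forestShape {x : BinaryTree Unit} {ts : List PlaneTree} (h : forestShape ts = x) :
    x.numNodes = (ts.flatMap labels).length := by
  induction x generalizing ts with
  | nil =>
    cases ts with
    | nil => rfl
    | cons t ts => cases t; simp [forestShape_cons] at h
  | node u l r ihl ihr =>
    cases ts with
    | nil => simp [forestShape] at h
    | cons t ts =>
      cases t with
      | node a cs =>
        rw [forestShape_cons] at h
        injection h with _ h₁ h₂
        simp [BinaryTree.numNodes, ihl h₁, ihr h₂, labels_node]

theorem forestShape_injective {x : BinaryTree Unit} {ts us : List PlaneTree}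
    (h₁ : forestShape ts = x) (h₂ : forestShape us = x)
    (h : ts.flatMap labels = us.flatMap labels) : ts = us := by
  induction x generalizing ts us with
  | nil =>
    have key : ∀ ts, forestShape ts = .nil → ts = [] := by
      rintro (_ | ⟨⟨a, cs⟩, ts⟩) h
      · rfl
      · simp [forestShape_cons] at h
    rw [key ts h₁, key us h₂]
  | node u l r ihl ihr =>
    rcases ts with _ | ⟨⟨a, cs⟩, ts⟩
    · simp [forestShape] at h₁
    rcases us with _ | ⟨⟨b, ds⟩, us⟩
    · simp [forestShape] at h₂
    rw [forestShape_cons] at h₁ h₂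
    injection h₁ with _ h₁ h₁'
    injection h₂ with _ h₂ h₂'
    simp only [List.flatMap_cons, labels_node, List.cons_append, List.cons.injEq] at h
    obtain ⟨rfl, h⟩ := h
    obtain ⟨h, h'⟩ := List.append_inj h
      ((numNodes_forestShape h₁).symm.trans (numNodes_forestShape h₂))
    rw [ihl h₁ h₂ h, ihr h₁' h₂' h']

end PlaneTree

/-- There are at most `catalan n * (n + 1)!` labelled plane trees with `n` edges. -/
theorem finite_and_ncard_isLabelled_le (n : ℕ) :
    {T : PlaneTree | T.IsLabelled n}.Finite ∧
      {T : PlaneTree | T.IsLabelled n}.ncard ≤ catalan n * (n + 1).factorial := by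
  classical
  set l : List ℕ := (Finset.Icc 1 (n + 1)).toList with hl
  have hlm : (l : Multiset ℕ) = (Finset.Icc 1 (n + 1)).val := Finset.coe_toList _
  set A : Finset (BinaryTree Unit × List ℕ) :=
    BinaryTree.treesOfNumNodesEq n ×ˢ l.permutations.toFinset with hA
  have hmaps : ∀ T ∈ {T : PlaneTree | T.IsLabelled n},
      (PlaneTree.forestShape T.children, T.labels) ∈ (A : Set (BinaryTree Unit × List ℕ)) := by
    intro T (hT : (T.labels : Multiset ℕ) = _)
    rw [← hlm, Multiset.coe_eq_coe] at hT
    have hlen := hT.length_eq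
    rw [hl, Finset.length_toList, Nat.card_Icc] at hlen
    obtain ⟨a, cs⟩ := T
    simp only [hA, Finset.coe_product, Set.mem_prod, Finset.mem_coe,
      BinaryTree.mem_treesOfNumNodesEq, List.mem_toFinset, List.mem_permutations]
    refine ⟨?_, hT⟩
    rw [PlaneTree.numNodes_forestShape rfl]
    simpa [PlaneTree.labels_node] using hlen
  have hinj : Set.InjOn (fun T : PlaneTree => (PlaneTree.forestShape T.children, T.labels))
      {T : PlaneTree | T.IsLabelled n} := by
    rintro ⟨a, cs⟩ - ⟨b, ds⟩ - h
    simp only [Prod.mk.injEq, PlaneTree.labels_node, PlaneTree.children_node,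
      List.cons.injEq] at h
    rw [h.2.1, PlaneTree.forestShape_injective h.1 rfl h.2.2]
  refine ⟨Set.Finite.of_injOn hmaps hinj A.finite_toSet, ?_⟩
  refine (Set.ncard_le_ncard_of_injOn _ hmaps hinj A.finite_toSet).trans ?_
  rw [Set.ncard_coe_finset, hA, Finset.card_product, BinaryTree.treesOfNumNodesEq_card_eq_catalan]
  refine Nat.mul_le_mul_left _ ((List.toFinset_card_le _).trans ?_)
  rw [List.length_permutations, hl, Finset.length_toList, Nat.card_Icc]
  simp

theorem catalan_mul_factorial (n : ℕ) :
    catalan n * (n + 1).factorial * n.factorial = (2 * n).factorial := by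
  have h₁ := succ_mul_catalan_eq_centralBinom n
  have h₂ := Nat.choose_mul_factorial_mul_factorial (show n ≤ 2 * n by omega)
  rw [← Nat.centralBinom_eq_two_mul_choose, ← h₁, show 2 * n - n = n by omega] at h₂
  rw [← h₂, Nat.factorial_succ]
  ring

namespace Chen

theorem IsMatchSet.mem_bounds {n : ℕ} {F : Finset (ℕ × ℕ)} (hF : IsMatchSet n F) {m : ℕ × ℕ}
    (hm : m ∈ F) : (1 ≤ m.1 ∧ m.1 ≤ 2 * n) ∧ (1 ≤ m.2 ∧ m.2 ≤ 2 * n) := by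
  have h : ∀ a ∈ ({m.1, m.2} : Multiset ℕ), a ∈ Finset.Icc 1 (2 * n) := by
    intro a ha
    rw [← Finset.mem_val, ← hF]
    exact Multiset.mem_of_le (Finset.single_le_sum (f := fun m : ℕ × ℕ => ({m.1, m.2} : Multiset ℕ))
      (fun _ _ => Multiset.zero_le _) hm) ha
  have h₁ := Finset.mem_Icc.1 (h m.1 (by simp))
  have h₂ := Finset.mem_Icc.1 (h m.2 (by simp))
  exact ⟨h₁, h₂⟩

theorem IsMatchSet.card_eq {n : ℕ} {F : Finset (ℕ × ℕ)} (hF : IsMatchSet n F) : F.card = n := by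
  have h := congrArg Multiset.card hF
  rw [Multiset.card_sum] at h
  simp at h
  omega

/-- The sets of matches with `n` edges, as a finite set. -/
noncomputable def matchSets (n : ℕ) : Finset (Finset (ℕ × ℕ)) :=
  open Classical in
  (Finset.Icc 1 (2 * n) ×ˢ Finset.Icc 1 (2 * n)).powerset.filter (IsMatchSet n)

theorem mem_matchSets {n : ℕ} {F : Finset (ℕ × ℕ)} : F ∈ matchSets n ↔ IsMatchSet n F := by
  simp only [matchSets, Finset.mem_filter, Finset.mem_powerset, and_iff_right_iff_imp]
  intro hF m hm
  simpa [and_assoc] using hF.mem_bounds hm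

/-- A numbering of the labels by pairs (match, end of the match) is determined by the resulting
set of matches together with an enumeration of this set. -/
theorem factorial_le_card_matchSets_mul (n : ℕ) :
    (2 * n).factorial ≤ (matchSets n).card * n.factorial := by
  classical
  set I := Finset.Icc 1 (2 * n) with hI
  have hc : Fintype.card (Fin n × Fin 2) = Fintype.card I := by simp [hI]; omega
  set P := (Fin n × Fin 2) ≃ I
  let pr : P → Fin n → ℕ × ℕ := fun e k => ((e (k, 0) : ℕ), (e (k, 1) : ℕ))
  have hpr : ∀ e, Function.Injective (pr e) := by
    intro e k l h
    have := (Prod.mk.injEq _ _ _ _ ▸ h).1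
    have := e.injective (Subtype.ext this)
    exact congrArg Prod.fst this
  let Φ : P → Finset (ℕ × ℕ) := fun e => Finset.univ.image (pr e)
  have hΦ : ∀ e ∈ (Finset.univ : Finset P), Φ e ∈ matchSets n := by
    intro e _
    rw [mem_matchSets, IsMatchSet, Finset.sum_image (fun a _ b _ h => hpr e h)]
    have h₁ : ∑ x : Fin n × Fin 2, ({(e x : ℕ)} : Multiset ℕ) = I.val := by
      rw [Equiv.sum_comp e (fun y : I => ({(y : ℕ)} : Multiset ℕ)),
        Finset.sum_coe_sort I (fun y => ({y} : Multiset ℕ)), Finset.sum_multiset_singleton]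
    rw [← h₁, Fintype.sum_prod_type]
    refine Finset.sum_congr rfl fun k _ => ?_
    rw [Fin.sum_univ_two]
    rfl
  have hcard : Fintype.card P = (2 * n).factorial := by
    rw [Fintype.card_equiv (Fintype.equivOfCardEq hc), hc]
    simp [hI]
  have h := Finset.card_le_mul_card_image_of_maps_to hΦ n.factorial ?_
  · rw [Finset.card_univ, hcard] at h
    rwa [mul_comm (matchSets n).card]
  intro F hF
  have hFc : Fintype.card (Fin n) = Fintype.card F := by
    simp [(mem_matchSets.1 hF).card_eq]
  rw [show n.factorial = Fintype.card (Fin n ≃ F) by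
    rw [Fintype.card_equiv (Fintype.equivOfCardEq hFc)]; simp, ← Finset.card_univ]
  have hmem : ∀ e ∈ Finset.univ.filter (fun e : P => Φ e = F), ∀ k, pr e k ∈ F := by
    intro e he k
    rw [← (Finset.mem_filter.1 he).2]
    exact Finset.mem_image_of_mem _ (Finset.mem_univ _)
  have hfun : (Finset.univ.filter (fun e : P => Φ e = F)).card ≤
      ((Finset.univ : Finset (Fin n ≃ F)).image
        (fun s => fun k => ((s k : F) : ℕ × ℕ))).card := by
    refine Finset.card_le_card_of_injOn pr ?_ ?_
    · intro e he
      have hm := hmem e he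
      rw [Finset.mem_coe, Finset.mem_image]
      have hb : Function.Bijective (fun k => (⟨pr e k, hm k⟩ : F)) := by
        rw [Fintype.bijective_iff_injective_and_card]
        exact ⟨fun a b h => hpr e (congrArg Subtype.val h), hFc⟩
      exact ⟨Equiv.ofBijective _ hb, Finset.mem_univ _, rfl⟩
    · intro e _ e' _ h
      refine Equiv.ext fun x => Subtype.ext ?_
      obtain ⟨k, i⟩ := x
      have hk := congrFun h k
      simp only [pr, Prod.mk.injEq] at hk
      fin_cases i
      · exact hk.1
      · exact hk.2
  exact hfun.trans Finset.card_image_le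

theorem ncard_isLabelled_le_card_matchSets (n : ℕ) :
    {T : PlaneTree | T.IsLabelled n}.ncard ≤ (matchSets n).card := by
  have h₁ := (finite_and_ncard_isLabelled_le n).2
  have h₂ := factorial_le_card_matchSets_mul n
  rw [← catalan_mul_factorial] at h₂
  exact h₁.trans (Nat.le_of_mul_le_mul_right h₂ n.factorial_pos)

end Chen

/-! ### The states of the merging algorithm -/

namespace Chen

open PlaneTree

/-- The tree made of `T` and `U` in one round, where `j` is the root or a leaf of `U`. -/
def merge (j : ℕ) (T U : PlaneTree) : PlaneTree :=
  if U.root = j then .node T.root (T.children ++ U.children) else replace j T U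

theorem step_iff {n : ℕ} {S S' : Set PlaneTree} :
    Step n S S' ↔ ∃ T U j, Selects n S T U j ∧ (U.root = j ∨ IsSubtree (.node j []) U) ∧
      S' = insert (merge j T U) (S \ {T, U}) := by
  constructor
  · rintro (⟨T, U, j, h, hj⟩ | ⟨T, U, j, h, hj, hl⟩)
    · exact ⟨T, U, j, h, Or.inl hj, by rw [merge, if_pos hj]⟩
    · exact ⟨T, U, j, h, Or.inr hl, by rw [merge, if_neg hj]⟩
  · rintro ⟨T, U, j, h, hj, rfl⟩
    rw [merge]
    split_ifs with hr
    · exact .horizontal S T U j h hr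
    · exact .vertical S T U j h hr (hj.resolve_left hr)

/-- `V` has an edge, and a marked vertex of `V` is a leaf or a root with a single child. -/
def MarksExposed (n : ℕ) (V : PlaneTree) : Prop :=
  V.children ≠ [] ∧ ∀ a cs, IsSubtree (.node a cs) V → Marked n a →
    cs = [] ∨ (a = V.root ∧ cs.length = 1)

/-- The properties that the set of trees has in the merging algorithm when `j` is the next
marked vertex to be merged. -/
def IsState (n j : ℕ) (S : Set PlaneTree) : Prop :=
  ∃ L : List PlaneTree, S = {V | V ∈ L} ∧ L.length + j = 2 * n + 2 ∧
    (L.flatMap labels : Multiset ℕ) = (Finset.Icc 1 (n + 1)).val + (Finset.Icc j (2 * n)).val ∧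
    ∀ V ∈ L, MarksExposed n V

theorem isState_initial {n : ℕ} (hn : 1 ≤ n) {F : Finset (ℕ × ℕ)} (hF : IsMatchSet n F) :
    IsState n (n + 2) (initial F) := by
  refine ⟨F.toList.map matchTree, ?_, ?_, ?_, ?_⟩
  · ext T
    simp [initial, eq_comm]
  · simp [hF.card_eq]; omega
  · have h : ∀ l : List (ℕ × ℕ), (((l.map matchTree).flatMap labels : List ℕ) : Multiset ℕ) =
        (l.map fun m => ({m.1, m.2} : Multiset ℕ)).sum := by
      intro l
      induction l with
      | nil => rfl
      | cons m l ih =>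
        rw [List.map_cons, List.flatMap_cons, List.map_cons, List.sum_cons, ← ih,
          ← Multiset.coe_add]
        simp [matchTree, labels_node]
    rw [h, Finset.sum_map_toList, hF]
    have hd : Disjoint (Finset.Icc 1 (n + 1)) (Finset.Icc (n + 2) (2 * n)) := by
      rw [Finset.disjoint_left]
      intro a ha hb
      rw [Finset.mem_Icc] at ha hb
      omega
    rw [← Finset.disjUnion_val _ _ hd, Finset.val_inj]
    ext a
    simp only [Finset.mem_disjUnion, Finset.mem_Icc]
    omega
  · intro V hV
    obtain ⟨m, -, rfl⟩ := List.mem_map.1 hV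
    refine ⟨by simp [matchTree], fun a cs h _ => ?_⟩
    rcases isSubtree_node.1 h with h | ⟨t, ht, h⟩
    · cases h
      exact Or.inr ⟨rfl, rfl⟩
    · rw [List.mem_singleton] at ht
      subst ht
      rcases isSubtree_node.1 h with h | ⟨t, ht, h⟩
      · cases h
        exact Or.inl rfl
      · simp at ht

section

variable {n j : ℕ} {S : Set PlaneTree}

theorem nodup_flatMap_labels {L : List PlaneTree} (hj : n + 2 ≤ j)
    (h : (L.flatMap labels : Multiset ℕ) =
      (Finset.Icc 1 (n + 1)).val + (Finset.Icc j (2 * n)).val) : (L.flatMap labels).Nodup := by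
  rw [← Multiset.coe_nodup, h, Multiset.nodup_add]
  refine ⟨Finset.nodup _, Finset.nodup _, ?_⟩
  rw [Finset.disjoint_val, Finset.disjoint_left]
  intro a ha hb
  rw [Finset.mem_Icc] at ha hb
  omega

theorem nodup_of_nodup_flatMap_labels {L : List PlaneTree} (h : (L.flatMap labels).Nodup) :
    L.Nodup := by
  rw [List.nodup_flatMap] at h
  refine h.2.imp fun {T U} hTU => ?_
  rintro rfl
  exact hTU (root_mem_labels T) (root_mem_labels T)

theorem IsState.nodup (h : IsState n j S) (hj : n + 2 ≤ j) {V : PlaneTree} (hV : V ∈ S) :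
    V.labels.Nodup := by
  obtain ⟨L, rfl, -, hL, -⟩ := h
  exact (List.nodup_flatMap.1 (nodup_flatMap_labels hj hL)).1 V hV

theorem IsState.eq_of_mem (h : IsState n j S) (hj : n + 2 ≤ j) {V W : PlaneTree} (hV : V ∈ S)
    (hW : W ∈ S) {a : ℕ} (haV : a ∈ V.labels) (haW : a ∈ W.labels) : V = W := by
  obtain ⟨L, rfl, -, hL, -⟩ := h
  exact eq_of_nodup_flatMap (nodup_flatMap_labels hj hL) hV hW haV haW

theorem IsState.exists_mem_labels_iff (h : IsState n j S) {a : ℕ} :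
    (∃ V ∈ S, a ∈ V.labels) ↔ (1 ≤ a ∧ a ≤ n + 1) ∨ (j ≤ a ∧ a ≤ 2 * n) := by
  obtain ⟨L, rfl, -, hL, -⟩ := h
  have := congrArg (a ∈ ·) hL
  simpa using this

theorem IsState.marksExposed (h : IsState n j S) {V : PlaneTree} (hV : V ∈ S) :
    MarksExposed n V := by
  obtain ⟨L, rfl, -, -, hL⟩ := h
  exact hL V hV

theorem IsState.finite (h : IsState n j S) : S.Finite := by
  obtain ⟨L, rfl, -⟩ := h
  exact L.finite_toSet

/-- There is one tree more than there are marked vertices, so some tree has no marked vertex. -/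
theorem IsState.exists_unmarked (h : IsState n j S) (hj : n + 2 ≤ j) (hj' : j ≤ 2 * n + 1) :
    ∃ T ∈ S, Unmarked n T := by
  classical
  by_contra! hcon
  have h' := h
  obtain ⟨L, rfl, hlen, hL, -⟩ := h
  have hnd := nodup_flatMap_labels hj hL
  have hm : ∀ V ∈ L, ∃ a ∈ V.labels, Marked n a := by
    intro V hV
    have := hcon V hV
    simp only [Unmarked, not_forall, not_not] at this
    obtain ⟨a, ha, hm⟩ := this
    exact ⟨a, ha, hm⟩
  choose! g hg hgm using hm
  have hle : L.toFinset.card ≤ (Finset.Icc j (2 * n)).card := by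
    refine Finset.card_le_card_of_injOn g ?_ ?_
    · intro V hV
      have hV : V ∈ L := by simpa using hV
      have h1 := h'.exists_mem_labels_iff.1 ⟨V, hV, hg V hV⟩
      have h2 := hgm V hV
      simp only [Finset.coe_Icc, Set.mem_Icc]
      omega
    · intro V hV W hW hVW
      have hV : V ∈ L := by simpa using hV
      have hW : W ∈ L := by simpa using hW
      have := hg V hV
      rw [hVW] at this
      exact eq_of_nodup_flatMap hnd hV hW this (hg W hW)
  rw [List.toFinset_card_of_nodup (nodup_of_nodup_flatMap_labels hnd), Nat.card_Icc] at hle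
  omega

theorem IsState.exists_selects (h : IsState n j S) (hj : n + 2 ≤ j) (hj' : j ≤ 2 * n) :
    ∃ T U, Selects n S T U j := by
  obtain ⟨T₀, hT₀⟩ := h.exists_unmarked hj (by omega)
  obtain ⟨T, hT, hmin⟩ := Set.exists_min_image {T | T ∈ S ∧ Unmarked n T} PlaneTree.root
    (h.finite.subset fun _ h => h.1) ⟨T₀, hT₀⟩
  obtain ⟨U, hU, hjU⟩ := h.exists_mem_labels_iff.2 (Or.inr ⟨le_refl j, hj'⟩)
  refine ⟨T, U, ⟨hT.1, hT.2, fun T' h₁ h₂ => hmin T' ⟨h₁, h₂⟩⟩, hU, hjU, by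
    unfold Marked; omega, fun V hV k hk hm => ?_⟩
  have := h.exists_mem_labels_iff.1 ⟨V, hV, hk⟩
  unfold Marked at hm
  omega

theorem IsState.selects_unique (h : IsState n j S) (hj : n + 2 ≤ j) {T U T' U' : PlaneTree}
    {k l : ℕ} (h₁ : Selects n S T U k) (h₂ : Selects n S T' U' l) :
    T = T' ∧ U = U' ∧ k = l := by
  obtain ⟨⟨hT, hTu, hTm⟩, hU, hk, hkm, hkmin⟩ := h₁
  obtain ⟨⟨hT', hTu', hTm'⟩, hU', hl, hlm, hlmin⟩ := h₂
  have hkl : k = l := le_antisymm (hkmin U' hU' l hl hlm) (hlmin U hU k hk hkm)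
  subst hkl
  have hr : T.root = T'.root := le_antisymm (hTm T' hT' hTu') (hTm' T hT hTu)
  refine ⟨h.eq_of_mem hj hT hT' (root_mem_labels T) (hr ▸ root_mem_labels T'),
    h.eq_of_mem hj hU hU' hk hl, rfl⟩

theorem IsState.selects_mark (h : IsState n j S) (hj : n + 2 ≤ j) (hj' : j ≤ 2 * n)
    {T U : PlaneTree} {k : ℕ} (h₁ : Selects n S T U k) : k = j := by
  obtain ⟨T', U', h₂⟩ := h.exists_selects hj hj'
  exact (h.selects_unique hj h₁ h₂).2.2

theorem MarksExposed.root_or_leaf {V : PlaneTree} (h : MarksExposed n V) {a : ℕ}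
    (ha : a ∈ V.labels) (hm : Marked n a) : V.root = a ∨ IsSubtree (.node a []) V := by
  obtain ⟨cs, hcs⟩ := exists_isSubtree_of_mem_labels ha
  rcases h.2 a cs hcs hm with rfl | ⟨h, -⟩
  · exact Or.inr hcs
  · exact Or.inl h.symm

theorem Selects.ne {T U : PlaneTree} (h : Selects n S T U j) : T ≠ U := by
  rintro rfl
  exact h.1.2.1 j h.2.2.1 h.2.2.2.1

theorem merge_labels {T U : PlaneTree} (hU : U.labels.Nodup)
    (h : U.root = j ∨ IsSubtree (.node j []) U) :
    ((merge j T U).labels : Multiset ℕ) + {j} =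
      (T.labels : Multiset ℕ) + (U.labels : Multiset ℕ) := by
  rw [merge]
  split_ifs with hr
  · obtain ⟨a, cs⟩ := T
    obtain ⟨b, ds⟩ := U
    simp only [root_node] at hr
    subst hr
    simp only [root_node, children_node, labels_node, List.flatMap_append, ← Multiset.cons_coe,
      ← Multiset.coe_add, ← Multiset.singleton_add]
    abel
  · exact labels_replace hU (h.resolve_left hr)

theorem mem_merge_labels {T U : PlaneTree} (hU : U.labels.Nodup)
    (h : U.root = j ∨ IsSubtree (.node j []) U) (hjT : j ∉ T.labels) {a : ℕ} :
    a ∈ (merge j T U).labels ↔ a ∈ T.labels ∨ (a ∈ U.labels ∧ a ≠ j) := by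
  have he := merge_labels (T := T) hU h
  have hjU : j ∈ U.labels := by
    rcases h with rfl | h
    · exact root_mem_labels U
    · exact h.root_mem
  by_cases haj : a = j
  · subst haj
    have := congrArg (Multiset.count a) he
    simp only [Multiset.count_add, Multiset.coe_count, Multiset.count_singleton_self,
      List.count_eq_one_of_mem hU hjU, List.count_eq_zero_of_not_mem hjT] at this
    have h0 : List.count a (merge a T U).labels = 0 := by omega
    rw [List.count_eq_zero] at h0
    simp [h0, hjT]
  · have := congrArg (a ∈ ·) he
    simp only [Multiset.mem_add, Multiset.mem_coe, Multiset.mem_singleton, haj, or_false,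
      eq_iff_iff] at this
    simp [this, haj]

theorem leaf_of_root_ne {U : PlaneTree} (hU : MarksExposed n U) (hm : Marked n j)
    (hr : U.root ≠ j) : ∀ cs, IsSubtree (.node j cs) U → cs = [] := fun cs hcs =>
  (hU.2 j cs hcs hm).resolve_right fun h => hr h.1.symm

theorem marksExposed_merge {T U : PlaneTree} (hT : MarksExposed n T) (hTu : Unmarked n T)
    (hU : MarksExposed n U) (hnd : U.labels.Nodup)
    (h : U.root = j ∨ IsSubtree (.node j []) U) : MarksExposed n (merge j T U) := by
  rw [merge]
  split_ifs with hr
  · refine ⟨by simp [hT.1], fun a cs hs hm => Or.inl ?_⟩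
    obtain ⟨b, es⟩ := T
    obtain ⟨c, ds⟩ := U
    rcases isSubtree_node.1 hs with hs | ⟨t, ht, hs⟩
    · cases hs
      exact (hTu _ (root_mem_labels (.node b es)) hm).elim
    · simp only [children_node] at ht
      rcases List.mem_append.1 ht with ht | ht
      · exact (hTu a (IsSubtree.root_mem (.child _ t _ _ ht hs)) hm).elim
      · refine (hU.2 a cs (.child _ t _ _ ht hs) hm).resolve_right fun h => ?_
        rw [labels_node, List.nodup_cons] at hnd
        refine hnd.1 (List.mem_flatMap.2 ⟨t, ht, ?_⟩)
        have := hs.root_mem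
        rwa [h.1] at this
  · have hl := h.resolve_left hr
    refine ⟨?_, fun a cs hs hm => ?_⟩
    · obtain ⟨c, ds⟩ := U
      rw [replace_node, if_neg (by simpa using hr)]
      simpa using hU.1
    · rcases isSubtree_replace hs with hs' | ⟨ds, hs', rfl, -⟩
      · exact (hTu a hs'.root_mem hm).elim
      · rw [root_replace, if_neg hr]
        simpa using hU.2 a ds hs' hm

theorem IsState.merge (h : IsState n j S) (hj : n + 2 ≤ j) (hj' : j ≤ 2 * n) {T U : PlaneTree}
    (hs : Selects n S T U j) : IsState n (j + 1) (insert (merge j T U) (S \ {T, U})) := by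
  classical
  have hne := hs.ne
  have hUe := h.marksExposed hs.2.1
  have hTe := h.marksExposed hs.1.1
  have hUn := h.nodup hj hs.2.1
  have hjU := hUe.root_or_leaf hs.2.2.1 hs.2.2.2.1
  obtain ⟨L, rfl, hlen, hL, hLm⟩ := h
  have hTL : T ∈ L := hs.1.1
  have hUL : U ∈ L.erase T := (List.mem_erase_of_ne hne.symm).2 hs.2.1
  have hp : L.Perm (T :: U :: (L.erase T).erase U) :=
    (List.perm_cons_erase hTL).trans ((List.perm_cons_erase hUL).cons T)
  set L₀ := (L.erase T).erase U
  have hndL := (hp.nodup_iff).1 (nodup_of_nodup_flatMap_labels (nodup_flatMap_labels hj hL))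
  simp only [List.nodup_cons, List.mem_cons, not_or] at hndL
  refine ⟨Chen.merge j T U :: L₀, ?_, ?_, ?_, ?_⟩
  · ext V
    simp only [Set.mem_insert_iff, Set.mem_sdiff, Set.mem_ofPred_eq, Set.mem_singleton_iff,
      List.mem_cons, hp.mem_iff]
    constructor
    · rintro (h | ⟨h | h | h, h'⟩) <;> simp_all
    · rintro (h | h)
      · exact Or.inl h
      · refine Or.inr ⟨Or.inr (Or.inr h), ?_⟩
        rintro (rfl | rfl)
        · exact hndL.1.2 h
        · exact hndL.2.1 h
  · have := hp.length_eq
    simp only [List.length_cons] at this ⊢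
    omega
  · have hL' : ((T :: U :: L₀).flatMap labels : Multiset ℕ) =
        (Finset.Icc 1 (n + 1)).val + (Finset.Icc j (2 * n)).val := by
      rw [← hL, Multiset.coe_eq_coe]
      exact (hp.flatMap_right labels).symm
    have hIcc : (Finset.Icc j (2 * n)).val = {j} + (Finset.Icc (j + 1) (2 * n)).val := by
      rw [Finset.Icc_eq_cons_Ioc hj', Finset.cons_val, ← Multiset.singleton_add,
        Finset.Icc_add_one_left_eq_Ioc]
    rw [hIcc] at hL'
    simp only [List.flatMap_cons, ← Multiset.coe_add] at hL' ⊢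
    have hm := merge_labels (T := T) hUn hjU
    apply add_right_cancel (b := ({j} : Multiset ℕ))
    calc _ = ((Chen.merge j T U).labels : Multiset ℕ) + {j} + (L₀.flatMap labels : Multiset ℕ) := by
          abel
      _ = _ := by rw [hm, add_assoc, hL']; abel
  · intro V hV
    rcases List.mem_cons.1 hV with rfl | hV
    · exact marksExposed_merge hTe hs.1.2.1 hUe hUn hjU
    · exact hLm V (hp.mem_iff.2 (by simp [hV]))

end

end Chen

/-! ### The run of the merging algorithm -/

namespace Chen

open PlaneTree

section Edges

/-- Some tree of `S` has the edge `(p, k, c)`. -/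
def EdgeIn (S : Set PlaneTree) (p k c : ℕ) : Prop := ∃ V ∈ S, Edge V p k c

theorem edge_merge {j : ℕ} {T U : PlaneTree} (hU : U.labels.Nodup)
    (hl : U.root ≠ j → ∀ cs, IsSubtree (.node j cs) U → cs = []) (hjU : j ∈ U.labels)
    {p k c : ℕ} :
    Edge (merge j T U) p k c ↔ Edge T p k c ∨ ∃ p₀ k₀ c₀, Edge U p₀ k₀ c₀ ∧
      p = (if p₀ = j then T.root else p₀) ∧
      k = k₀ + (if p₀ = j then T.children.length else 0) ∧ c = if c₀ = j then T.root else c₀ := by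
  rw [merge]
  split_ifs with hr
  · obtain ⟨a, cs⟩ := T
    obtain ⟨b, ds⟩ := U
    change b = j at hr
    subst hr
    have hroot : ∀ {p₀ k₀ c₀}, Edge (node b ds) p₀ k₀ c₀ → c₀ ≠ b := by
      rintro p₀ k₀ c₀ h rfl
      exact not_edge_root hU h
    simp only [root_node, children_node]
    have hb : ∀ t ∈ ds, b ∉ t.labels := by
      intro t ht hbt
      rw [labels_node, List.nodup_cons] at hU
      exact hU.1 (List.mem_flatMap.2 ⟨t, ht, hbt⟩)
    rw [edge_node, edge_node]
    constructor
    · rintro (⟨rfl, t, ht, rfl⟩ | ⟨t, ht, he⟩)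
      · rw [List.getElem?_append] at ht
        split_ifs at ht with hk
        · exact Or.inl (Or.inl ⟨rfl, t, ht, rfl⟩)
        · have he : Edge (node b ds) b (k - cs.length) t.root :=
            edge_node.2 (Or.inl ⟨rfl, t, ht, rfl⟩)
          refine Or.inr ⟨b, _, _, he, by simp, by simp; omega, ?_⟩
          rw [if_neg (hroot he)]
      · rcases List.mem_append.1 ht with ht | ht
        · exact Or.inl (Or.inr ⟨t, ht, he⟩)
        · have he' : Edge (node b ds) p k c := edge_node.2 (Or.inr ⟨t, ht, he⟩)
          have hp : p ≠ b := by
            rintro rfl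
            exact hb t ht he.left_mem
          exact Or.inr ⟨p, k, c, he', by simp [hp], by simp [hp], by simp [hroot he']⟩
    · rintro ((⟨rfl, t, ht, rfl⟩ | ⟨t, ht, he⟩) | ⟨p₀, k₀, c₀, he, rfl, rfl, rfl⟩)
      · refine Or.inl ⟨rfl, t, ?_, rfl⟩
        rw [List.getElem?_append_left (List.getElem?_eq_some_iff.1 ht).1]
        exact ht
      · exact Or.inr ⟨t, List.mem_append_left _ ht, he⟩
      · rw [if_neg (hroot he)]
        rcases edge_node.1 he with ⟨rfl, t, ht, rfl⟩ | ⟨t, ht, he'⟩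
        · refine Or.inl ⟨by simp, t, ?_, rfl⟩
          rw [if_pos rfl, List.getElem?_append_right (by omega), Nat.add_sub_cancel]
          exact ht
        · have hp : p₀ ≠ b := by
            rintro rfl
            exact hb t ht he'.left_mem
          rw [if_neg hp, if_neg hp]
          exact Or.inr ⟨t, List.mem_append_right _ ht, he'⟩
  · rw [edge_replace (hl hr)]
    refine or_congr (and_iff_right hjU) ⟨?_, ?_⟩
    · rintro ⟨d, he, rfl⟩
      have hp : p ≠ j := by
        rintro rfl
        obtain ⟨cs, t, hs, ht, -⟩ := he
        rw [hl hr cs hs] at ht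
        simp at ht
      exact ⟨p, k, d, he, by simp [hp], by simp [hp], rfl⟩
    · rintro ⟨p₀, k₀, c₀, he, rfl, rfl, rfl⟩
      have hp : p₀ ≠ j := by
        rintro rfl
        obtain ⟨cs, t, hs, ht, -⟩ := he
        rw [hl hr cs hs] at ht
        simp at ht
      rw [if_neg hp, if_neg hp]
      exact ⟨c₀, he, rfl⟩

/-- One round acts on the edges by substitution: the mark `j` becomes the root of the selected tree
`T`, and an edge that started in `j` is moved behind the children of this root. -/
theorem edgeIn_merge {n j : ℕ} {S : Set PlaneTree} (h : IsState n j S) (hj : n + 2 ≤ j)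
    {T U : PlaneTree} (hs : Selects n S T U j) {p k c : ℕ} :
    EdgeIn (insert (merge j T U) (S \ {T, U})) p k c ↔ ∃ p₀ k₀ c₀, EdgeIn S p₀ k₀ c₀ ∧
      p = (if p₀ = j then T.root else p₀) ∧
      k = k₀ + (if p₀ = j then T.children.length else 0) ∧ c = if c₀ = j then T.root else c₀ := by
  have hU := h.nodup hj hs.2.1
  have hl : U.root ≠ j → ∀ cs, IsSubtree (.node j cs) U → cs = [] :=
    leaf_of_root_ne (h.marksExposed hs.2.1) hs.2.2.2.1
  have hother : ∀ V ∈ S, V ≠ U → j ∉ V.labels := fun V hV hne hjV =>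
    hne (h.eq_of_mem hj hV hs.2.1 hjV hs.2.2.1)
  have hedge : ∀ V ∈ S, V ≠ U → ∀ p₀ k₀ c₀, Edge V p₀ k₀ c₀ → p₀ ≠ j ∧ c₀ ≠ j := by
    intro V hV hne p₀ k₀ c₀ he
    constructor
    · rintro rfl
      exact hother V hV hne he.left_mem
    · rintro rfl
      exact hother V hV hne he.right_mem
  constructor
  · rintro ⟨V, hV | ⟨hV, hV'⟩, he⟩
    · rw [hV, edge_merge hU hl hs.2.2.1] at he
      rcases he with he | ⟨p₀, k₀, c₀, he, h₁⟩
      · have := hedge T hs.1.1 hs.ne p k c he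
        exact ⟨p, k, c, ⟨T, hs.1.1, he⟩, by simp [this]⟩
      · exact ⟨p₀, k₀, c₀, ⟨U, hs.2.1, he⟩, h₁⟩
    · have hVU : V ≠ U := fun e => hV' (Or.inr e)
      have := hedge V hV hVU p k c he
      exact ⟨p, k, c, ⟨V, hV, he⟩, by simp [this]⟩
  · rintro ⟨p₀, k₀, c₀, ⟨V, hV, he⟩, h₁⟩
    by_cases hVU : V = U
    · subst hVU
      exact ⟨_, Or.inl rfl, (edge_merge hU hl hs.2.2.1).2 (Or.inr ⟨p₀, k₀, c₀, he, h₁⟩)⟩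
    · have hne := hedge V hV hVU p₀ k₀ c₀ he
      simp only [hne.1, hne.2, if_false, Nat.add_zero] at h₁
      obtain ⟨rfl, rfl, rfl⟩ := h₁
      by_cases hVT : V = T
      · subst hVT
        exact ⟨_, Or.inl rfl, (edge_merge hU hl hs.2.2.1).2 (Or.inl he)⟩
      · exact ⟨V, Or.inr ⟨hV, by simp [hVT, hVU]⟩, he⟩

end Edges

theorem IsState.ncard {n j : ℕ} {S : Set PlaneTree} (h : IsState n j S) (hj : n + 2 ≤ j) :
    S.ncard + j = 2 * n + 2 := by
  classical
  obtain ⟨L, rfl, hlen, hL, -⟩ := h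
  rw [show {V | V ∈ L} = (L.toFinset : Set PlaneTree) by ext; simp, Set.ncard_coe_finset,
    List.toFinset_card_of_nodup (nodup_of_nodup_flatMap_labels (nodup_flatMap_labels hj hL)), hlen]

open Classical in
/-- One round of the algorithm as a function; a set of trees without a successor is kept. -/
noncomputable def next (n : ℕ) (S : Set PlaneTree) : Set PlaneTree :=
  if h : ∃ S', Step n S S' then h.choose else S

/-- The set of trees in the algorithm for `F` when the marks below `j` have been merged. -/
noncomputable def state (n : ℕ) (F : Finset (ℕ × ℕ)) (j : ℕ) : Set PlaneTree :=
  (next n)^[j - (n + 2)] (initial F)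

open Classical in
/-- The root of the tree that is merged at the mark `j`; the junk value `0` occurs only when the
algorithm has no round for `j`. -/
noncomputable def fill (n : ℕ) (F : Finset (ℕ × ℕ)) (j : ℕ) : ℕ :=
  if h : ∃ T U, Selects n (state n F j) T U j then h.choose.root else 0

/-- The number of marks below `j` at which a tree with root `i` is merged. -/
noncomputable def fillCount (n : ℕ) (F : Finset (ℕ × ℕ)) (j i : ℕ) : ℕ :=
  ((Finset.Ico (n + 2) j).filter fun k => fill n F k = i).card

/-- The label that `a` has become when the marks below `j` have been merged. -/
noncomputable def sub (n : ℕ) (F : Finset (ℕ × ℕ)) (j a : ℕ) : ℕ :=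
  if n + 1 < a ∧ a < j then fill n F a else a

/-- The position, among the children of its upper end, of the edge that came from a match with
root `a`, when the marks below `j` have been merged. -/
noncomputable def idx (n : ℕ) (F : Finset (ℕ × ℕ)) (j a : ℕ) : ℕ :=
  if n + 1 < a ∧ a < j then fillCount n F a (fill n F a) + 1 else 0

theorem state_start (n : ℕ) (F : Finset (ℕ × ℕ)) : state n F (n + 2) = initial F := by
  simp [state]

theorem state_succ {n j : ℕ} (hj : n + 2 ≤ j) (F : Finset (ℕ × ℕ)) :
    state n F (j + 1) = next n (state n F j) := by
  rw [state, show j + 1 - (n + 2) = (j - (n + 2)) + 1 by omega, Function.iterate_succ_apply',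
    state]

theorem fillCount_succ {n j : ℕ} (hj : n + 2 ≤ j) (F : Finset (ℕ × ℕ)) (i : ℕ) :
    fillCount n F (j + 1) i = fillCount n F j i + if fill n F j = i then 1 else 0 := by
  rw [fillCount, ← Finset.insert_Ico_right_eq_Ico_add_one hj, Finset.filter_insert]
  split_ifs with h
  · rw [Finset.card_insert_of_notMem (by simp), fillCount]
  · rfl

theorem fillCount_mono {n j k : ℕ} (h : j ≤ k) (F : Finset (ℕ × ℕ)) (i : ℕ) :
    fillCount n F j i ≤ fillCount n F k i :=
  Finset.card_le_card (Finset.filter_subset_filter _ (Finset.Ico_subset_Ico_right h))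

theorem fillCount_lt {n j k : ℕ} {F : Finset (ℕ × ℕ)} {i : ℕ} (hj : n + 2 ≤ j) (h : j < k)
    (hi : fill n F j = i) : fillCount n F j i < fillCount n F k i := by
  have h₁ := fillCount_mono (n := n) (Nat.succ_le_of_lt h) F i
  have h₂ := fillCount_succ hj F i
  rw [if_pos hi] at h₂
  simp only [Nat.succ_eq_add_one] at h₁
  omega

section Run

variable {n j : ℕ} {F : Finset (ℕ × ℕ)}

theorem next_eq {S : Set PlaneTree} (h : IsState n j S) (hj : n + 2 ≤ j) (hj' : j ≤ 2 * n)
    {T U : PlaneTree} (hs : Selects n S T U j) :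
    next n S = insert (merge j T U) (S \ {T, U}) := by
  have hstep : Step n S (insert (merge j T U) (S \ {T, U})) := step_iff.2
    ⟨T, U, j, hs, (h.marksExposed hs.2.1).root_or_leaf hs.2.2.1 hs.2.2.2.1, rfl⟩
  have hex : ∃ S', Step n S S' := ⟨_, hstep⟩
  rw [next, dif_pos hex]
  obtain ⟨T', U', k, hs', -, he⟩ := step_iff.1 hex.choose_spec
  obtain ⟨rfl, rfl, rfl⟩ := h.selects_unique hj hs' hs
  exact he

theorem isState_state (hn : 1 ≤ n) (hF : IsMatchSet n F) (hj : n + 2 ≤ j) (hj' : j ≤ 2 * n + 1) :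
    IsState n j (state n F j) := by
  induction j, hj using Nat.le_induction with
  | base => rw [state_start]; exact isState_initial hn hF
  | succ j hj ih =>
    have ih := ih (by omega)
    obtain ⟨T, U, hs⟩ := ih.exists_selects hj (by omega)
    rw [state_succ hj, next_eq ih hj (by omega) hs]
    exact ih.merge hj (by omega) hs

theorem fill_eq (hn : 1 ≤ n) (hF : IsMatchSet n F) (hj : n + 2 ≤ j) (hj' : j ≤ 2 * n)
    {T U : PlaneTree} (hs : Selects n (state n F j) T U j) : fill n F j = T.root := by
  have h := isState_state hn hF hj (by omega)
  have hex : ∃ T U, Selects n (state n F j) T U j := ⟨T, U, hs⟩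
  rw [fill, dif_pos hex]
  obtain ⟨U', hs'⟩ := hex.choose_spec
  rw [(h.selects_unique hj hs' hs).1]

theorem exists_round (hn : 1 ≤ n) (hF : IsMatchSet n F) (hj : n + 2 ≤ j) (hj' : j ≤ 2 * n) :
    ∃ T U, Selects n (state n F j) T U j ∧ fill n F j = T.root ∧
      state n F (j + 1) = insert (merge j T U) (state n F j \ {T, U}) := by
  have h := isState_state hn hF hj (by omega)
  obtain ⟨T, U, hs⟩ := h.exists_selects hj hj'
  exact ⟨T, U, hs, fill_eq hn hF hj hj' hs, by rw [state_succ hj, next_eq h hj hj' hs]⟩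

theorem fill_le (hn : 1 ≤ n) (hF : IsMatchSet n F) (hj : n + 2 ≤ j) (hj' : j ≤ 2 * n) :
    fill n F j ≤ n + 1 := by
  obtain ⟨T, U, hs, hf, -⟩ := exists_round hn hF hj hj'
  rw [hf]
  exact not_lt.1 (hs.1.2.1 _ (root_mem_labels T))

theorem reaches_iff (hn : 1 ≤ n) (hF : IsMatchSet n F) {S : Set PlaneTree} :
    Reaches n F S ↔ ∃ j, n + 2 ≤ j ∧ j ≤ 2 * n + 1 ∧ S = state n F j := by
  constructor
  · intro h
    induction h with
    | refl => exact ⟨n + 2, le_rfl, by omega, (state_start n F).symm⟩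
    | tail _ hstep ih =>
      obtain ⟨j, hj, hj', rfl⟩ := ih
      have h := isState_state hn hF hj hj'
      obtain ⟨T, U, k, hs, -, rfl⟩ := step_iff.1 hstep
      have hk := h.exists_mem_labels_iff.1 ⟨U, hs.2.1, hs.2.2.1⟩
      have hm : n + 1 < k := hs.2.2.2.1
      obtain rfl := h.selects_mark hj (by omega) hs
      exact ⟨k + 1, by omega, by omega, by rw [state_succ hj, next_eq h hj (by omega) hs]⟩
  · rintro ⟨j, hj, hj', rfl⟩
    induction j, hj using Nat.le_induction with
    | base => rw [state_start]; exact .refl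
    | succ j hj ih =>
      have h := isState_state hn hF hj (by omega)
      obtain ⟨T, U, hs⟩ := h.exists_selects hj (by omega)
      rw [state_succ hj, next_eq h hj (by omega) hs]
      exact (ih (by omega)).tail (step_iff.2
        ⟨T, U, j, hs, (h.marksExposed hs.2.1).root_or_leaf hs.2.2.1 hs.2.2.2.1, rfl⟩)

theorem decomposes_iff (hn : 1 ≤ n) {T : PlaneTree} :
    Decomposes n T F ↔ IsMatchSet n F ∧ state n F (2 * n + 1) = {T} := by
  refine and_congr_right fun hF => ?_
  rw [reaches_iff hn hF]
  constructor
  · rintro ⟨j, hj, hj', h⟩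
    have hc := (isState_state hn hF hj hj').ncard hj
    rw [← h, Set.ncard_singleton] at hc
    obtain rfl : j = 2 * n + 1 := by omega
    exact h.symm
  · intro h
    exact ⟨2 * n + 1, by omega, le_rfl, h.symm⟩

theorem exists_state_eq_singleton (hn : 1 ≤ n) (hF : IsMatchSet n F) :
    ∃ T, state n F (2 * n + 1) = {T} := by
  rw [← Set.ncard_eq_one]
  have := (isState_state hn hF (j := 2 * n + 1) (by omega) le_rfl).ncard (by omega)
  omega

theorem Decomposes.isLabelled (hn : 1 ≤ n) {T : PlaneTree} (h : Decomposes n T F) :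
    T.IsLabelled n := by
  obtain ⟨hF, h⟩ := (decomposes_iff hn).1 h
  obtain ⟨L, hS, hlen, hL, -⟩ := isState_state hn hF (j := 2 * n + 1) (by omega) le_rfl
  obtain ⟨V, rfl⟩ := List.length_eq_one_iff.1 (show L.length = 1 by omega)
  rw [h] at hS
  have hVT : V = T := by
    have : V ∈ ({T} : Set PlaneTree) := by rw [hS]; simp
    simpa using this
  subst hVT
  simpa [IsLabelled] using hL

/-- Every earlier merge at an unmarked root has been horizontal and has added one child. -/
theorem children_length_eq (hn : 1 ≤ n) (hF : IsMatchSet n F) (hj : n + 2 ≤ j)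
    (hj' : j ≤ 2 * n + 1) {V : PlaneTree} (hV : V ∈ state n F j) (hu : ¬ Marked n V.root) :
    V.children.length = 1 + fillCount n F j V.root := by
  induction j, hj using Nat.le_induction generalizing V with
  | base =>
    rw [state_start] at hV
    obtain ⟨m, -, rfl⟩ := hV
    simp [matchTree, fillCount]
  | succ j hj ih =>
    have hst := isState_state hn hF hj (by omega)
    obtain ⟨T, U, hs, hf, he⟩ := exists_round hn hF hj (by omega)
    rw [he] at hV
    rw [fillCount_succ hj, hf]
    have hTr : ∀ W ∈ state n F j, W ≠ T → T.root ≠ W.root := fun W hW hne h =>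
      hne (hst.eq_of_mem hj hW hs.1.1 (root_mem_labels W) (h ▸ root_mem_labels T))
    rcases hV with rfl | ⟨hV, hne⟩
    · rw [merge] at hu ⊢
      split_ifs at hu ⊢ with hr h₁ h₁
      · simp only [root_node, children_node, List.length_append] at hu h₁ ⊢
        rw [ih (by omega) hs.1.1 hu]
        have hU := hst.marksExposed hs.2.1
        rcases hU.2 _ _ (isSubtree_root U) (hr ▸ hs.2.2.2.1) with h | h
        · exact (hU.1 h).elim
        · omega
      · exact (h₁ rfl).elim
      · rw [root_replace, if_neg hr] at h₁
        exact (hTr U hs.2.1 hs.ne.symm h₁).elim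
      · rw [root_replace, if_neg hr] at hu ⊢
        rw [Nat.add_zero, ← ih (by omega) hs.2.1 hu]
        obtain ⟨a, cs⟩ := U
        rw [replace_node, if_neg (by simpa using hr)]
        simp
    · rw [if_neg (hTr V hV fun e => hne (Or.inl e)), ih (by omega) hV hu, Nat.add_zero]

theorem sub_succ (hn : 1 ≤ n) (hF : IsMatchSet n F) (hj : n + 2 ≤ j) (hj' : j ≤ 2 * n) (a : ℕ) :
    sub n F (j + 1) a = if sub n F j a = j then fill n F j else sub n F j a := by
  unfold sub
  by_cases h : n + 1 < a ∧ a < j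
  · have := fill_le hn hF (j := a) (by omega) (by omega)
    rw [if_pos h, if_pos (by omega), if_neg (by omega)]
  · rw [if_neg h]
    split_ifs with h₁ h₂ h₂
    · rw [h₂]
    · omega
    · omega
    · rfl

theorem sub_eq_self_iff (hn : 1 ≤ n) (hF : IsMatchSet n F) (hj : n + 2 ≤ j) (hj' : j ≤ 2 * n)
    (a : ℕ) : sub n F j a = j ↔ a = j := by
  unfold sub
  split_ifs with h
  · have := fill_le hn hF (j := a) (by omega) (by omega)
    omega
  · rfl

theorem idx_succ (hn : 1 ≤ n) (hF : IsMatchSet n F) (hj : n + 2 ≤ j) (hj' : j ≤ 2 * n) (a : ℕ) :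
    idx n F (j + 1) a =
      idx n F j a + if sub n F j a = j then fillCount n F j (fill n F j) + 1 else 0 := by
  simp only [sub_eq_self_iff hn hF hj hj']
  unfold idx
  split_ifs with h₁ h₂ h₃ h₃ <;> first | omega | skip
  rw [h₃]; omega

/-- The edges at any time of the algorithm are the matches of `F`, where every merged mark is
replaced by the root of the tree that was merged at it. -/
theorem edgeIn_state_iff (hn : 1 ≤ n) (hF : IsMatchSet n F) (hj : n + 2 ≤ j)
    (hj' : j ≤ 2 * n + 1) {p k c : ℕ} :
    EdgeIn (state n F j) p k c ↔
      ∃ m ∈ F, p = sub n F j m.1 ∧ k = idx n F j m.1 ∧ c = sub n F j m.2 := by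
  induction j, hj using Nat.le_induction generalizing p k c with
  | base =>
    have h₁ : ∀ a, sub n F (n + 2) a = a := fun a => if_neg (by omega)
    have h₂ : ∀ a, idx n F (n + 2) a = 0 := fun a => if_neg (by omega)
    simp only [h₁, h₂, state_start, EdgeIn, initial, matchTree]
    constructor
    · rintro ⟨V, ⟨m, hm, rfl⟩, he⟩
      rcases edge_node.1 he with ⟨rfl, t, ht, rfl⟩ | ⟨t, ht, he⟩
      · rw [List.getElem?_eq_some_iff] at ht
        obtain ⟨hk, rfl⟩ := ht
        obtain rfl : k = 0 := by simpa using hk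
        exact ⟨m, hm, rfl, rfl, rfl⟩
      · rw [List.mem_singleton] at ht
        subst ht
        rcases edge_node.1 he with ⟨rfl, t, ht, rfl⟩ | ⟨t, ht, he⟩ <;> simp at ht
    · rintro ⟨m, hm, rfl, rfl, rfl⟩
      exact ⟨_, ⟨m, hm, rfl⟩, edge_node.2 (Or.inl ⟨rfl, .node m.2 [], rfl, rfl⟩)⟩
  | succ j hj ih =>
    have hst := isState_state hn hF hj (by omega)
    obtain ⟨T, U, hs, hf, he⟩ := exists_round hn hF hj (by omega)
    have hd := children_length_eq hn hF hj (by omega) hs.1.1 (hs.1.2.1 _ (root_mem_labels T))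
    rw [he, edgeIn_merge hst hj hs]
    simp only [sub_succ hn hF hj (show j ≤ 2 * n by omega),
      idx_succ hn hF hj (show j ≤ 2 * n by omega), ih (by omega), hf, hd]
    constructor
    · rintro ⟨p₀, k₀, c₀, ⟨m, hm, rfl, rfl, rfl⟩, rfl, rfl, rfl⟩
      refine ⟨m, hm, rfl, ?_, rfl⟩
      rw [Nat.add_comm 1]
    · rintro ⟨m, hm, rfl, rfl, rfl⟩
      refine ⟨_, _, _, ⟨m, hm, rfl, rfl, rfl⟩, rfl, ?_, rfl⟩
      rw [Nat.add_comm 1]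

end Run

end Chen

/-! ### Uniqueness and existence of the decomposition -/

theorem PlaneTree.Edge.of_le {T : PlaneTree} {p k l c : ℕ} (h : PlaneTree.Edge T p k c)
    (hl : l ≤ k) : ∃ d, PlaneTree.Edge T p l d := by
  obtain ⟨cs, t, hs, ht, -⟩ := h
  have hk := (List.getElem?_eq_some_iff.1 ht).1
  exact ⟨_, cs, cs[l], hs, List.getElem?_eq_getElem (by omega), rfl⟩

namespace Chen

open PlaneTree

section MatchSet

variable {n : ℕ} {F : Finset (ℕ × ℕ)}

theorem IsMatchSet.nodup_pair (hF : IsMatchSet n F) {m m' : ℕ × ℕ} (hm : m ∈ F) (hm' : m' ∈ F)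
    (hne : m ≠ m') : (({m.1, m.2} : Multiset ℕ) + {m'.1, m'.2}).Nodup := by
  have h : ({m.1, m.2} : Multiset ℕ) + {m'.1, m'.2} ≤ (Finset.Icc 1 (2 * n)).val := by
    rw [← hF, ← Finset.sum_pair (f := fun m : ℕ × ℕ => ({m.1, m.2} : Multiset ℕ)) hne]
    refine Finset.sum_le_sum_of_subset fun x hx => ?_
    rcases Finset.mem_insert.1 hx with rfl | hx
    · exact hm
    · rwa [Finset.mem_singleton.1 hx]
  exact Multiset.nodup_of_le h (Finset.nodup _)

theorem IsMatchSet.fst_ne_snd (hF : IsMatchSet n F) {m m' : ℕ × ℕ} (hm : m ∈ F) (hm' : m' ∈ F) :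
    m.1 ≠ m'.2 := by
  intro h
  by_cases hne : m = m'
  · subst hne
    have h₁ : ({m.1, m.2} : Multiset ℕ) ≤ (Finset.Icc 1 (2 * n)).val := by
      rw [← hF]
      exact Finset.single_le_sum (f := fun m : ℕ × ℕ => ({m.1, m.2} : Multiset ℕ))
        (fun _ _ => Multiset.zero_le _) hm
    have := Multiset.nodup_of_le h₁ (Finset.nodup _)
    simp [h] at this
  · have := hF.nodup_pair hm hm' hne
    simp [h] at this

end MatchSet

section Fill

variable {n j : ℕ} {F : Finset (ℕ × ℕ)} {T : PlaneTree}

theorem sub_of_le {a : ℕ} (h : a ≤ n + 1) : sub n F j a = a := if_neg (by omega)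

theorem sub_of_lt {a : ℕ} (h : n + 1 < a) (h' : a < j) : sub n F j a = fill n F a :=
  if_pos ⟨h, h'⟩

theorem sub_of_ge {a : ℕ} (h : j ≤ a) : sub n F j a = a := if_neg (by omega)

theorem idx_of_le {a : ℕ} (h : a ≤ n + 1) : idx n F j a = 0 := if_neg (by omega)

theorem idx_of_lt {a : ℕ} (h : n + 1 < a) (h' : a < j) :
    idx n F j a = fillCount n F a (fill n F a) + 1 :=
  if_pos ⟨h, h'⟩

theorem eq_of_fillCount_eq {a b i : ℕ} (ha : n + 2 ≤ a) (hb : n + 2 ≤ b) (hai : fill n F a = i)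
    (hbi : fill n F b = i) (h : fillCount n F a i = fillCount n F b i) : a = b := by
  rcases lt_trichotomy a b with hab | hab | hab
  · have := fillCount_lt ha hab hai; omega
  · exact hab
  · have := fillCount_lt hb hab hbi; omega

/-- The upper end of an edge, once unmarked, and the position of the edge below it do not change any
more. -/
theorem edgeIn_state_mono (hn : 1 ≤ n) (hF : IsMatchSet n F) (hj : n + 2 ≤ j) {l : ℕ}
    (hjl : j ≤ l) (hl : l ≤ 2 * n + 1) {p k c : ℕ} (h : EdgeIn (state n F j) p k c)
    (hp : p ≤ n + 1) : ∃ d, EdgeIn (state n F l) p k d := by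
  obtain ⟨m, hm, rfl, rfl, rfl⟩ := (edgeIn_state_iff hn hF hj (by omega)).1 h
  refine ⟨sub n F l m.2, (edgeIn_state_iff hn hF (by omega) hl).2 ⟨m, hm, ?_, ?_, rfl⟩⟩ <;>
  · rcases Nat.lt_or_ge (n + 1) m.1 with h₁ | h₁
    · rcases Nat.lt_or_ge m.1 j with h₂ | h₂
      · first
          | rw [sub_of_lt h₁ h₂, sub_of_lt h₁ (by omega)]
          | rw [idx_of_lt h₁ h₂, idx_of_lt h₁ (by omega)]
      · rw [sub_of_ge h₂] at hp
        omega
    · first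
        | rw [sub_of_le h₁, sub_of_le h₁]
        | rw [idx_of_le h₁, idx_of_le h₁]

theorem edge_iff (hn : 1 ≤ n) (hF : IsMatchSet n F) (hT : state n F (2 * n + 1) = {T})
    {p k c : ℕ} : Edge T p k c ↔ ∃ m ∈ F, p = sub n F (2 * n + 1) m.1 ∧
      k = idx n F (2 * n + 1) m.1 ∧ c = sub n F (2 * n + 1) m.2 := by
  rw [← edgeIn_state_iff hn hF (by omega) le_rfl, hT]
  simp [EdgeIn]

/-- The tree merged at `j` has `fillCount n F j (fill n F j) + 1` children at its root, and these
edges stay. -/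
theorem exists_edge_fill (hn : 1 ≤ n) (hF : IsMatchSet n F) (hT : state n F (2 * n + 1) = {T})
    (hj : n + 2 ≤ j) (hj' : j ≤ 2 * n) {k : ℕ} (hk : k ≤ fillCount n F j (fill n F j)) :
    ∃ c, Edge T (fill n F j) k c := by
  obtain ⟨V, U, hs, hf, -⟩ := exists_round hn hF hj hj'
  have hu := hs.1.2.1 _ (root_mem_labels V)
  have hl := children_length_eq hn hF hj (by omega) hs.1.1 hu
  have hk' : k < V.children.length := by rw [hl, ← hf]; omega
  have he : EdgeIn (state n F j) V.root k V.children[k].root :=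
    ⟨V, hs.1.1, _, V.children[k], isSubtree_root V, List.getElem?_eq_getElem hk', rfl⟩
  obtain ⟨d, hd⟩ := edgeIn_state_mono hn hF hj (show j ≤ 2 * n + 1 by omega) le_rfl he
    (not_lt.1 hu)
  rw [hT] at hd
  obtain ⟨W, rfl, hd⟩ := hd
  exact ⟨d, hf ▸ hd⟩

/-- A tree that has been merged at the marked leaf of a match gets no further children at its
root. -/
theorem not_edge_fill_snd (hn : 1 ≤ n) (hF : IsMatchSet n F) (hT : state n F (2 * n + 1) = {T})
    {m : ℕ × ℕ} (hm : m ∈ F) (hmm : Marked n m.2) {k c : ℕ}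
    (hk : fillCount n F m.2 (fill n F m.2) < k) : ¬ Edge T (fill n F m.2) k c := by
  intro he
  obtain ⟨d, hd⟩ := he.of_le (Nat.succ_le_of_lt hk)
  obtain ⟨m', hm', h₁, h₂, -⟩ := (edge_iff hn hF hT).1 hd
  rcases Nat.lt_or_ge (n + 1) m'.1 with h | h
  · have hb := (hF.mem_bounds hm').1
    rw [sub_of_lt h (by omega)] at h₁
    rw [idx_of_lt h (by omega), ← h₁] at h₂
    exact hF.fst_ne_snd hm' hm
      (eq_of_fillCount_eq (by omega) hmm h₁.symm rfl (Nat.succ.inj h₂).symm)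
  · rw [idx_of_le h] at h₂
    omega

/-- A selected root is the root of a match of `F`. -/
theorem exists_fill_mem (hn : 1 ≤ n) (hF : IsMatchSet n F) (hj : n + 2 ≤ j) (hj' : j ≤ 2 * n) :
    ∃ b, (fill n F j, b) ∈ F := by
  induction j using Nat.strong_induction_on with
  | _ j ih =>
    obtain ⟨V, U, hs, hf, -⟩ := exists_round hn hF hj hj'
    have hst := isState_state hn hF hj (by omega)
    have hu : V.root ≤ n + 1 := not_lt.1 (hs.1.2.1 _ (root_mem_labels V))
    have hk : 0 < V.children.length := List.length_pos_iff.2 (hst.marksExposed hs.1.1).1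
    have he : EdgeIn (state n F j) V.root 0 V.children[0].root :=
      ⟨V, hs.1.1, _, V.children[0], isSubtree_root V, List.getElem?_eq_getElem hk, rfl⟩
    obtain ⟨m, hm, h₁, -, -⟩ := (edgeIn_state_iff hn hF hj (by omega)).1 he
    rw [hf]
    rcases Nat.lt_or_ge (n + 1) m.1 with h | h
    · rcases Nat.lt_or_ge m.1 j with h₂ | h₂
      · rw [sub_of_lt h h₂] at h₁
        rw [h₁]
        exact ih m.1 h₂ (by omega) (by omega)
      · rw [sub_of_ge h₂] at h₁
        omega
    · rw [sub_of_le h] at h₁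
      exact ⟨m.2, h₁ ▸ hm⟩

/-- The label of the leaf of a match never labels an interior vertex of the final tree: if it is
unmarked, it stays a leaf. -/
theorem not_edge_snd (hn : 1 ≤ n) (hF : IsMatchSet n F) (hT : state n F (2 * n + 1) = {T})
    {m : ℕ × ℕ} (hm : m ∈ F) {k c : ℕ} : ¬ Edge T m.2 k c := by
  intro he
  obtain ⟨m', hm', h₁, -, -⟩ := (edge_iff hn hF hT).1 he
  rcases Nat.lt_or_ge (n + 1) m'.1 with h | h
  · have hb := (hF.mem_bounds hm').1
    rw [sub_of_lt h (by omega)] at h₁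
    obtain ⟨b, hb⟩ := exists_fill_mem hn hF (j := m'.1) (by omega) (by omega)
    exact hF.fst_ne_snd hb hm h₁.symm
  · rw [sub_of_le h] at h₁
    exact hF.fst_ne_snd hm' hm h₁.symm

end Fill

section Unique

variable {n j : ℕ} {F F' : Finset (ℕ × ℕ)} {T : PlaneTree}

theorem fillCount_congr (h : ∀ k, n + 2 ≤ k → k < j → fill n F k = fill n F' k) {k : ℕ}
    (hk : k ≤ j) (i : ℕ) : fillCount n F k i = fillCount n F' k i := by
  unfold fillCount
  congr 1
  refine Finset.filter_congr fun l hl => ?_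
  rw [Finset.mem_Ico] at hl
  rw [h l hl.1 (by omega)]

/-- If two runs that end in the same tree agree before the time `j`, then the tree selected by the
first run at the time `j` has the same root as some unmarked tree of the second run, which selects
the smallest such root. -/
theorem fill_le_fill (hn : 1 ≤ n) (hF : IsMatchSet n F) (hF' : IsMatchSet n F')
    (hT : state n F (2 * n + 1) = {T}) (hT' : state n F' (2 * n + 1) = {T}) (hj : n + 2 ≤ j)
    (hj' : j ≤ 2 * n) (h : ∀ k, n + 2 ≤ k → k < j → fill n F k = fill n F' k) :
    fill n F' j ≤ fill n F j := by
  have hst := isState_state hn hF hj (by omega)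
  have hst' := isState_state hn hF' hj (by omega)
  obtain ⟨V, U, hs, hf, -⟩ := exists_round hn hF hj hj'
  obtain ⟨W, U', hs', hf', -⟩ := exists_round hn hF' hj hj'
  have hun : ∀ a ∈ V.labels, a ≤ n + 1 := fun a ha => not_lt.1 (hs.1.2.1 a ha)
  obtain ⟨V', hV', hi⟩ := hst'.exists_mem_labels_iff.2
    (Or.inl ⟨by
      have := hst.exists_mem_labels_iff.1 ⟨V, hs.1.1, root_mem_labels V⟩
      omega, hun _ (root_mem_labels V)⟩)
  -- The root of `V` is a root in the second run, since it has too few children to be final.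
  have hroot : V.root = V'.root := by
    rcases eq_root_or_exists_edge hi with h₀ | ⟨p, k, he⟩
    · exact h₀
    exfalso
    obtain ⟨m, hm, -, -, h₁⟩ := (edgeIn_state_iff hn hF' hj (by omega)).1 ⟨V', hV', he⟩
    obtain ⟨c, hc⟩ := exists_edge_fill hn hF hT hj hj' le_rfl
    rw [hf] at hc
    rcases Nat.lt_or_ge (n + 1) m.2 with h₂ | h₂
    · rcases Nat.lt_or_ge m.2 j with h₃ | h₃
      · rw [sub_of_lt h₂ h₃] at h₁
        rw [h₁] at hc
        refine not_edge_fill_snd hn hF' hT' hm h₂ ?_ hc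
        rw [fillCount_congr h le_rfl]
        exact fillCount_lt h₂ h₃ rfl
      · rw [sub_of_ge h₃] at h₁
        have := hun _ (root_mem_labels V)
        omega
    · rw [sub_of_le h₂] at h₁
      rw [h₁] at hc
      exact not_edge_snd hn hF' hT' hm hc
  -- All vertices of `V'` are vertices of `V`.
  have hsubset : ∀ x ∈ V'.labels, x ∈ V.labels := by
    refine edge_induction (hroot ▸ root_mem_labels V) fun p k c he hp => ?_
    have hpu := hun p hp
    obtain ⟨m', hm', h₁, h₂, rfl⟩ := (edgeIn_state_iff hn hF' hj (by omega)).1 ⟨V', hV', he⟩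
    have hb' := hF'.mem_bounds hm'
    have hjm : n + 1 < m'.1 → m'.1 < j := by
      intro h₃
      by_contra h₄
      rw [sub_of_ge (not_lt.1 h₄)] at h₁
      omega
    have hE : Edge T p k (sub n F' (2 * n + 1) m'.2) := by
      refine (edge_iff hn hF' hT').2 ⟨m', hm', ?_, ?_, rfl⟩
      · rcases Nat.lt_or_ge (n + 1) m'.1 with h₃ | h₃
        · rw [h₁, sub_of_lt h₃ (hjm h₃), sub_of_lt h₃ (by omega)]
        · rw [h₁, sub_of_le h₃, sub_of_le h₃]
      · rcases Nat.lt_or_ge (n + 1) m'.1 with h₃ | h₃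
        · rw [h₂, idx_of_lt h₃ (hjm h₃), idx_of_lt h₃ (by omega)]
        · rw [h₂, idx_of_le h₃, idx_of_le h₃]
    obtain ⟨m, hm, g₁, g₂, g₃⟩ := (edge_iff hn hF hT).1 hE
    have hb := hF.mem_bounds hm
    have hfst : m.1 = m'.1 := by
      rcases Nat.lt_or_ge (n + 1) m'.1 with h₃ | h₃
      · rw [sub_of_lt h₃ (hjm h₃), ← h m'.1 h₃ (hjm h₃)] at h₁
        rw [idx_of_lt h₃ (hjm h₃), ← h m'.1 h₃ (hjm h₃),
          ← fillCount_congr h (hjm h₃).le, ← h₁] at h₂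
        rcases Nat.lt_or_ge (n + 1) m.1 with h₄ | h₄
        · rw [sub_of_lt h₄ (by omega)] at g₁
          rw [idx_of_lt h₄ (by omega), ← g₁] at g₂
          exact eq_of_fillCount_eq h₄ h₃ g₁.symm h₁.symm (by omega)
        · rw [idx_of_le h₄] at g₂
          omega
      · rw [sub_of_le h₃] at h₁
        rw [idx_of_le h₃] at h₂
        rcases Nat.lt_or_ge (n + 1) m.1 with h₄ | h₄
        · rw [idx_of_lt h₄ (by omega)] at g₂
          omega
        · rw [sub_of_le h₄] at g₁
          omega
    have hEj : EdgeIn (state n F j) p k (sub n F j m.2) := by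
      refine (edgeIn_state_iff hn hF hj (by omega)).2 ⟨m, hm, ?_, ?_, rfl⟩
      · rw [hfst]
        rcases Nat.lt_or_ge (n + 1) m'.1 with h₃ | h₃
        · rw [h₁, sub_of_lt h₃ (hjm h₃), sub_of_lt h₃ (hjm h₃), h _ h₃ (hjm h₃)]
        · rw [h₁, sub_of_le h₃, sub_of_le h₃]
      · rw [hfst]
        rcases Nat.lt_or_ge (n + 1) m'.1 with h₃ | h₃
        · rw [h₂, idx_of_lt h₃ (hjm h₃), idx_of_lt h₃ (hjm h₃), h _ h₃ (hjm h₃),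
            fillCount_congr h (hjm h₃).le]
        · rw [h₂, idx_of_le h₃, idx_of_le h₃]
    obtain ⟨V₁, hV₁, he₁⟩ := hEj
    obtain rfl := hst.eq_of_mem hj hV₁ hs.1.1 he₁.left_mem hp
    have hd := he₁.right_mem
    have hdu := hun _ hd
    rcases Nat.lt_or_ge (n + 1) m.2 with h₃ | h₃
    · have h₄ : m.2 < j := by
        by_contra h₄
        rw [sub_of_ge (not_lt.1 h₄)] at hdu
        omega
      rw [sub_of_lt h₃ h₄] at hd
      rw [sub_of_lt h₃ (by omega)] at g₃
      obtain ⟨c, hc⟩ := exists_edge_fill hn hF hT (j := m.2) h₃ (by omega) (Nat.zero_le _)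
      rcases Nat.lt_or_ge (n + 1) m'.2 with h₅ | h₅
      · rw [sub_of_lt h₅ (by omega)] at g₃
        rcases Nat.lt_or_ge m'.2 j with h₆ | h₆
        · rwa [sub_of_lt h₅ h₆, g₃]
        · exfalso
          obtain ⟨c, hc⟩ := exists_edge_fill hn hF' hT' (j := m'.2) h₅ (by omega) le_rfl
          rw [g₃] at hc
          refine not_edge_fill_snd hn hF hT hm h₃ ?_ hc
          have e₁ := fillCount_lt (F := F) (n := n) h₃ h₄ rfl
          have e₂ := fillCount_mono (n := n) h₆ F' (fill n F m.2)
          rw [fillCount_congr h le_rfl] at e₁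
          omega
      · rw [sub_of_le h₅] at g₃
        rw [← g₃] at hc
        exact (not_edge_snd hn hF' hT' hm' hc).elim
    · rw [sub_of_le h₃] at hd g₃
      rcases Nat.lt_or_ge (n + 1) m'.2 with h₅ | h₅
      · rw [sub_of_lt h₅ (by omega)] at g₃
        obtain ⟨c, hc⟩ := exists_edge_fill hn hF' hT' (j := m'.2) h₅ (by omega) (Nat.zero_le _)
        rw [g₃] at hc
        exact (not_edge_snd hn hF hT hm hc).elim
      · rw [sub_of_le h₅] at g₃ ⊢
        rwa [g₃]
  rw [hf, hf', hroot]
  exact hs'.1.2.2 V' hV' fun a ha => not_lt.2 (hun a (hsubset a ha))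

theorem fill_eq_fill (hn : 1 ≤ n) (hF : IsMatchSet n F) (hF' : IsMatchSet n F')
    (hT : state n F (2 * n + 1) = {T}) (hT' : state n F' (2 * n + 1) = {T}) (hj : n + 2 ≤ j)
    (hj' : j ≤ 2 * n) : fill n F j = fill n F' j := by
  induction j using Nat.strong_induction_on with
  | _ j ih =>
    have h : ∀ k, n + 2 ≤ k → k < j → fill n F k = fill n F' k := fun k hk hkj =>
      ih k hkj hk (by omega)
    exact le_antisymm (fill_le_fill hn hF' hF hT' hT hj hj' fun k h₁ h₂ => (h k h₁ h₂).symm)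
      (fill_le_fill hn hF hF' hT hT' hj hj' h)

theorem subset_of_state_eq (hn : 1 ≤ n) (hF : IsMatchSet n F) (hF' : IsMatchSet n F')
    (hT : state n F (2 * n + 1) = {T}) (hT' : state n F' (2 * n + 1) = {T}) : F ⊆ F' := by
  have h : ∀ k, n + 2 ≤ k → k < 2 * n + 1 → fill n F k = fill n F' k := fun k h₁ h₂ =>
    fill_eq_fill hn hF hF' hT hT' h₁ (by omega)
  intro m hm
  obtain ⟨m', hm', h₁, h₂, h₃⟩ :=
    (edge_iff hn hF' hT').1 ((edge_iff hn hF hT).2 ⟨m, hm, rfl, rfl, rfl⟩)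
  have hb := hF.mem_bounds hm
  have hb' := hF'.mem_bounds hm'
  have hfst : m.1 = m'.1 := by
    rcases Nat.lt_or_ge (n + 1) m.1 with g | g <;> rcases Nat.lt_or_ge (n + 1) m'.1 with g' | g'
    · rw [sub_of_lt g (by omega), sub_of_lt g' (by omega), ← h m'.1 g' (by omega)] at h₁
      rw [idx_of_lt g (by omega), idx_of_lt g' (by omega), ← h m'.1 g' (by omega),
        ← fillCount_congr h (by omega), h₁] at h₂
      exact eq_of_fillCount_eq g g' h₁ rfl (Nat.succ.inj h₂)
    · rw [idx_of_lt g (by omega), idx_of_le g'] at h₂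
      omega
    · rw [idx_of_le g, idx_of_lt g' (by omega)] at h₂
      omega
    · rwa [sub_of_le g, sub_of_le g'] at h₁
  have hsnd : m.2 = m'.2 := by
    rcases Nat.lt_or_ge (n + 1) m.2 with g | g <;> rcases Nat.lt_or_ge (n + 1) m'.2 with g' | g'
    · rw [sub_of_lt g (by omega), sub_of_lt g' (by omega)] at h₃
      rcases lt_trichotomy m.2 m'.2 with hlt | heq | hlt
      · exfalso
        obtain ⟨c, hc⟩ := exists_edge_fill hn hF' hT' (j := m'.2) g' (by omega) le_rfl
        rw [← h₃] at hc
        refine not_edge_fill_snd hn hF hT hm g ?_ hc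
        rw [← fillCount_congr h (by omega)]
        exact fillCount_lt g hlt rfl
      · exact heq
      · exfalso
        obtain ⟨c, hc⟩ := exists_edge_fill hn hF hT (j := m.2) g (by omega) le_rfl
        rw [h₃] at hc
        refine not_edge_fill_snd hn hF' hT' hm' g' ?_ hc
        rw [fillCount_congr h (by omega)]
        exact fillCount_lt g' hlt rfl
    · rw [sub_of_lt g (by omega), sub_of_le g'] at h₃
      obtain ⟨c, hc⟩ := exists_edge_fill hn hF hT (j := m.2) g (by omega) (Nat.zero_le _)
      rw [h₃] at hc
      exact (not_edge_snd hn hF' hT' hm' hc).elim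
    · rw [sub_of_le g, sub_of_lt g' (by omega)] at h₃
      obtain ⟨c, hc⟩ := exists_edge_fill hn hF' hT' (j := m'.2) g' (by omega) (Nat.zero_le _)
      rw [← h₃] at hc
      exact (not_edge_snd hn hF hT hm hc).elim
    · rwa [sub_of_le g, sub_of_le g'] at h₃
  rwa [show m = m' from Prod.ext hfst hsnd]

theorem Decomposes.unique (hn : 1 ≤ n) (h : Decomposes n T F) (h' : Decomposes n T F') :
    F = F' := by
  obtain ⟨hF, hT⟩ := (decomposes_iff hn).1 h
  obtain ⟨hF', hT'⟩ := (decomposes_iff hn).1 h'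
  exact (subset_of_state_eq hn hF hF' hT hT').antisymm (subset_of_state_eq hn hF' hF hT' hT)

/-- The decomposition exists: sending a set of matches to its tree is injective, and there are
at least as many sets of matches as labelled plane trees. -/
theorem exists_decomposes (hn : 1 ≤ n) (hT : T.IsLabelled n) : ∃ F, Decomposes n T F := by
  classical
  have hex : ∀ F ∈ matchSets n, ∃ T, Decomposes n T F := by
    intro F hF
    have hF := mem_matchSets.1 hF
    obtain ⟨T, hT⟩ := exists_state_eq_singleton hn hF
    exact ⟨T, (decomposes_iff hn).2 ⟨hF, hT⟩⟩
  have : Nonempty PlaneTree := ⟨T⟩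
  choose! g hg using hex
  have hinj : Set.InjOn g (matchSets n : Set (Finset (ℕ × ℕ))) := fun F hF F' hF' h =>
    (hg F hF).unique hn (h ▸ hg F' hF')
  have hsub : g '' (matchSets n : Set (Finset (ℕ × ℕ))) ⊆ {T | T.IsLabelled n} := by
    rintro _ ⟨F, hF, rfl⟩
    exact (hg F hF).isLabelled hn
  have heq := Set.eq_of_subset_of_ncard_le hsub (by
    rw [hinj.ncard_image, Set.ncard_coe_finset]
    exact ncard_isLabelled_le_card_matchSets n) (finite_and_ncard_isLabelled_le n).1
  have hmem : T ∈ g '' (matchSets n : Set (Finset (ℕ × ℕ))) := heq ▸ hT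
  obtain ⟨F, hF, rfl⟩ := hmem
  exact ⟨F, hg F hF⟩

end Unique

end Chen

/-! ### The leaves of a tree in terms of its decomposition -/

namespace PlaneTree

theorem IsSubtree.trans {s t T : PlaneTree} (h₁ : IsSubtree s t) (h₂ : IsSubtree t T) :
    IsSubtree s T := by
  induction h₂ with
  | refl => exact h₁
  | child u a cs hu _ ih => exact .child s u a cs hu ih

theorem IsSubtree.of_mem {p : ℕ} {cs : List PlaneTree} {t T : PlaneTree}
    (h : IsSubtree (node p cs) T) (ht : t ∈ cs) : IsSubtree t T :=
  IsSubtree.trans (.child t t p cs ht (.refl t)) h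

theorem IsSubtree.children_eq_nil_iff {s T : PlaneTree} (hT : T.labels.Nodup)
    (h : IsSubtree s T) : s.children = [] ↔ ¬ ∃ c, Edge T s.root 0 c := by
  rw [← node_root_children s] at h
  rw [h.exists_edge_iff hT, not_lt, Nat.le_zero, List.length_eq_zero_iff]

theorem eq_leaf_iff {t : PlaneTree} {x : ℕ} : t = node x [] ↔ t.root = x ∧ t.children = [] := by
  obtain ⟨a, cs⟩ := t
  simp

section LeafKinds

variable {T : PlaneTree} {x : ℕ}

/-- `x` has no child in `T`. -/
def NoChild (T : PlaneTree) (x : ℕ) : Prop := ¬ ∃ c, Edge T x 0 c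

theorem mem_singletonLeaves_iff (hT : T.labels.Nodup) :
    x ∈ T.singletonLeaves ↔ ∃ p, Edge T p 0 x ∧ NoChild T x ∧ ¬ ∃ c, Edge T p 1 c := by
  constructor
  · rintro ⟨p, h⟩
    refine ⟨p, ⟨_, _, h, rfl, rfl⟩, ?_, ?_⟩
    · exact ((h.of_mem (List.mem_singleton_self _)).children_eq_nil_iff hT).1 rfl
    · rw [h.exists_edge_iff hT]
      simp
  · rintro ⟨p, ⟨cs, t, hs, ht, rfl⟩, hx, h₁⟩
    rw [hs.exists_edge_iff hT, not_lt] at h₁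
    have htm := List.mem_of_getElem? ht
    have hx' := ((hs.of_mem htm).children_eq_nil_iff hT).2 hx
    obtain ⟨u, rfl⟩ := List.length_eq_one_iff.1 (le_antisymm h₁ (List.length_pos_of_mem htm))
    rw [List.mem_singleton] at htm
    subst htm
    exact ⟨p, by rwa [← eq_leaf_iff.2 ⟨rfl, hx'⟩]⟩

/-- The common part of the descriptions of the two other kinds of elder leaves. -/
theorem exists_two_children_iff (hT : T.labels.Nodup) (P : Prop → Prop) :
    (∃ p s cs, IsSubtree (node p (node x [] :: s :: cs)) T ∧ P (s.children = [])) ↔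
      ∃ p y, Edge T p 0 x ∧ NoChild T x ∧ Edge T p 1 y ∧ P (NoChild T y) := by
  constructor
  · rintro ⟨p, s, cs, h, hs⟩
    refine ⟨p, s.root, ⟨_, _, h, rfl, rfl⟩, ?_, ⟨_, _, h, rfl, rfl⟩, ?_⟩
    · exact ((h.of_mem List.mem_cons_self).children_eq_nil_iff hT).1 rfl
    · have := (h.of_mem (List.mem_cons_of_mem _ List.mem_cons_self)).children_eq_nil_iff hT
      rwa [NoChild, ← this]
  · rintro ⟨p, y, ⟨cs, t, hs, ht, rfl⟩, hx, he, hy⟩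
    obtain ⟨u, hu, rfl⟩ := (hs.edge_iff hT).1 he
    have htn := ((hs.of_mem (List.mem_of_getElem? ht)).children_eq_nil_iff hT).2 hx
    have := (hs.of_mem (List.mem_of_getElem? hu)).children_eq_nil_iff hT
    rw [NoChild, ← this] at hy
    rcases cs with _ | ⟨v, _ | ⟨w, cs⟩⟩
    · simp at ht
    · simp at hu
    · simp only [List.getElem?_cons_zero, Option.some.injEq] at ht
      simp only [List.getElem?_cons_succ, List.getElem?_cons_zero, Option.some.injEq] at hu
      subst ht hu
      exact ⟨p, w, cs, by rwa [← htn, node_root_children], hy⟩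

theorem mem_elderTwinLeaves_iff (hT : T.labels.Nodup) : x ∈ T.elderTwinLeaves ↔
    ∃ p y, Edge T p 0 x ∧ NoChild T x ∧ Edge T p 1 y ∧ NoChild T y :=
  exists_two_children_iff hT id

theorem mem_elderNonTwinLeaves_iff (hT : T.labels.Nodup) : x ∈ T.elderNonTwinLeaves ↔
    ∃ p y, Edge T p 0 x ∧ NoChild T x ∧ Edge T p 1 y ∧ ¬ NoChild T y :=
  exists_two_children_iff hT Not

theorem mem_secondLeaves_iff (hT : T.labels.Nodup) : x ∈ T.secondLeaves ↔
    ∃ p, Edge T p 1 x ∧ NoChild T x := by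
  constructor
  · rintro ⟨p, s, cs, h⟩
    exact ⟨p, ⟨_, _, h, rfl, rfl⟩, ((h.of_mem (List.mem_cons_of_mem _
      List.mem_cons_self)).children_eq_nil_iff hT).1 rfl⟩
  · rintro ⟨p, ⟨cs, t, hs, ht, rfl⟩, hx⟩
    have htn := ((hs.of_mem (List.mem_of_getElem? ht)).children_eq_nil_iff hT).2 hx
    rcases cs with _ | ⟨v, _ | ⟨w, cs⟩⟩
    · simp at ht
    · simp at ht
    · simp only [List.getElem?_cons_succ, List.getElem?_cons_zero, Option.some.injEq] at ht
      subst ht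
      exact ⟨p, v, cs, by rwa [← htn, node_root_children]⟩

theorem mem_youngerLeaves_iff (hT : T.labels.Nodup) : x ∈ T.youngerLeaves ↔
    ∃ p k, 2 ≤ k ∧ Edge T p k x ∧ NoChild T x := by
  constructor
  · rintro ⟨p, s₁, s₂, cs, h, hx⟩
    obtain ⟨k, hk⟩ := List.mem_iff_getElem?.1 hx
    exact ⟨p, k + 2, by omega, ⟨_, _, h, by simpa using hk, rfl⟩, ((h.of_mem
      (List.mem_cons_of_mem _ (List.mem_cons_of_mem _ hx))).children_eq_nil_iff hT).1 rfl⟩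
  · rintro ⟨p, k, hk, ⟨cs, t, hs, ht, rfl⟩, hx⟩
    have htn := ((hs.of_mem (List.mem_of_getElem? ht)).children_eq_nil_iff hT).2 hx
    obtain ⟨k, rfl⟩ := Nat.exists_eq_add_of_le' hk
    rcases cs with _ | ⟨v, _ | ⟨w, cs⟩⟩
    · simp at ht
    · simp at ht
    · refine ⟨p, v, w, cs, hs, ?_⟩
      rw [← htn, node_root_children]
      exact List.mem_of_getElem? (by simpa using ht)

end LeafKinds

theorem IsLabelled.nodup {n : ℕ} {T : PlaneTree} (h : T.IsLabelled n) : T.labels.Nodup := by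
  rw [← Multiset.coe_nodup, h]
  exact Finset.nodup _

theorem IsLabelled.mem_labels_iff {n : ℕ} {T : PlaneTree} (h : T.IsLabelled n) {a : ℕ} :
    a ∈ T.labels ↔ 1 ≤ a ∧ a ≤ n + 1 := by
  rw [← Multiset.mem_coe, h, Finset.mem_val, Finset.mem_Icc]

end PlaneTree

namespace Chen

open PlaneTree

section FinalTree

variable {n j : ℕ} {F : Finset (ℕ × ℕ)} {T : PlaneTree}

theorem noChild_sub_iff (hn : 1 ≤ n) (hF : IsMatchSet n F) (hT : state n F (2 * n + 1) = {T})
    {m : ℕ × ℕ} (hm : m ∈ F) : NoChild T (sub n F (2 * n + 1) m.2) ↔ ¬ Marked n m.2 := by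
  have hb := (hF.mem_bounds hm).2
  constructor
  · intro h hmm
    rw [sub_of_lt hmm (by omega)] at h
    exact h (exists_edge_fill hn hF hT hmm hb.2 (Nat.zero_le _))
  · rintro h ⟨c, hc⟩
    rw [sub_of_le (not_lt.1 h)] at hc
    exact not_edge_snd hn hF hT hm hc

theorem edge_zero_iff (hn : 1 ≤ n) (hF : IsMatchSet n F) (hT : state n F (2 * n + 1) = {T})
    {p c : ℕ} : Edge T p 0 c ↔
      ∃ b, (p, b) ∈ F ∧ ¬ Marked n p ∧ c = sub n F (2 * n + 1) b := by
  rw [edge_iff hn hF hT]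
  constructor
  · rintro ⟨⟨a, b⟩, hm, h₁, h₂, h₃⟩
    have hb := (hF.mem_bounds hm).1
    have ha : ¬ Marked n a := by
      intro ha
      rw [idx_of_lt ha (by omega)] at h₂
      omega
    rw [sub_of_le (not_lt.1 ha)] at h₁
    subst h₁
    exact ⟨b, hm, ha, h₃⟩
  · rintro ⟨b, hm, hp, h⟩
    exact ⟨_, hm, (sub_of_le (not_lt.1 hp)).symm, (idx_of_le (not_lt.1 hp)).symm, h⟩

theorem edge_succ_iff (hn : 1 ≤ n) (hF : IsMatchSet n F) (hT : state n F (2 * n + 1) = {T})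
    {p k c : ℕ} : Edge T p (k + 1) c ↔ ∃ a b, (a, b) ∈ F ∧ Marked n a ∧ fill n F a = p ∧
      fillCount n F a p = k ∧ c = sub n F (2 * n + 1) b := by
  rw [edge_iff hn hF hT]
  constructor
  · rintro ⟨⟨a, b⟩, hm, h₁, h₂, h₃⟩
    have hb := (hF.mem_bounds hm).1
    have ha : Marked n a := by
      by_contra ha
      rw [idx_of_le (not_lt.1 ha)] at h₂
      omega
    simp only at h₁ h₂ hb
    rw [sub_of_lt ha (by omega)] at h₁
    rw [idx_of_lt ha (by omega), ← h₁] at h₂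
    exact ⟨a, b, hm, ha, h₁.symm, by omega, h₃⟩
  · rintro ⟨a, b, hm, ha, h₁, h₂, h₃⟩
    have hb := (hF.mem_bounds hm).1
    simp only at hb
    refine ⟨(a, b), hm, ?_, ?_, h₃⟩
    · rw [sub_of_lt ha (by omega), h₁]
    · rw [idx_of_lt ha (by omega), h₁, h₂]

/-- The first edge below an interior vertex comes from the match with this vertex as its root, and
its lower end is interior exactly when the leaf of the match is marked. -/
theorem isTipAugmented_iff (hn : 1 ≤ n) (hF : IsMatchSet n F) (hT : state n F (2 * n + 1) = {T}) :
    T.IsTipAugmented ↔ ∀ m ∈ F, ¬ TypeIII n m := by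
  have hnd := (((decomposes_iff hn).2 ⟨hF, hT⟩).isLabelled hn).nodup
  constructor
  · rintro h ⟨p, b⟩ hm ⟨hp, hb⟩
    obtain ⟨cs, t, hs, ht, htr⟩ := (edge_zero_iff hn hF hT).2 ⟨b, hm, hp, rfl⟩
    rcases cs with _ | ⟨v, cs⟩
    · simp at ht
    · simp only [List.getElem?_cons_zero, Option.some.injEq] at ht
      subst ht
      have h₁ := ((hs.of_mem List.mem_cons_self).children_eq_nil_iff hnd).1 (h p v cs hs)
      rw [htr] at h₁
      exact (noChild_sub_iff hn hF hT hm).1 h₁ hb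
  · intro h p s cs hs
    obtain ⟨b, hm, hp, hb⟩ := (edge_zero_iff hn hF hT).1 ⟨_, s, hs, rfl, rfl⟩
    rw [(hs.of_mem List.mem_cons_self).children_eq_nil_iff hnd, hb]
    exact (noChild_sub_iff hn hF hT hm).2 fun hbm => h _ hm ⟨hp, hbm⟩

/-- In the absence of matches of type iii, the leaves that are leftmost children are the leaves of
the matches of type i. -/
theorem edge_zero_and_noChild_iff (hn : 1 ≤ n) (hF : IsMatchSet n F)
    (hT : state n F (2 * n + 1) = {T}) (h₃ : ∀ m ∈ F, ¬ TypeIII n m) {p x : ℕ} :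
    (Edge T p 0 x ∧ NoChild T x) ↔ (p, x) ∈ F ∧ TypeI n (p, x) := by
  rw [edge_zero_iff hn hF hT]
  constructor
  · rintro ⟨⟨b, hm, hp, rfl⟩, -⟩
    have hb : ¬ Marked n b := fun hb => h₃ _ hm ⟨hp, hb⟩
    rw [sub_of_le (not_lt.1 hb)]
    exact ⟨hm, hp, hb⟩
  · rintro ⟨hm, hp, hx⟩
    have := (noChild_sub_iff hn hF hT hm).2 hx
    rw [sub_of_le (not_lt.1 hx)] at this
    exact ⟨⟨x, hm, hp, (sub_of_le (not_lt.1 hx)).symm⟩, this⟩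

theorem edge_succ_and_noChild_iff (hn : 1 ≤ n) (hF : IsMatchSet n F)
    (hT : state n F (2 * n + 1) = {T}) {p k x : ℕ} : (Edge T p (k + 1) x ∧ NoChild T x) ↔
      ∃ a, (a, x) ∈ F ∧ Marked n a ∧ ¬ Marked n x ∧ fill n F a = p ∧ fillCount n F a p = k := by
  rw [edge_succ_iff hn hF hT]
  constructor
  · rintro ⟨⟨a, b, hm, ha, h₁, h₂, rfl⟩, hx⟩
    have hb : ¬ Marked n b := (noChild_sub_iff hn hF hT hm).1 hx
    rw [sub_of_le (not_lt.1 hb)]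
    exact ⟨a, hm, ha, hb, h₁, h₂⟩
  · rintro ⟨a, hm, ha, hx, h₁, h₂⟩
    have := (noChild_sub_iff hn hF hT hm).2 hx
    rw [sub_of_le (not_lt.1 hx)] at this
    exact ⟨⟨a, x, hm, ha, h₁, h₂, (sub_of_le (not_lt.1 hx)).symm⟩, this⟩

theorem mem_secondLeaves_iff_fill (hn : 1 ≤ n) (hF : IsMatchSet n F)
    (hT : state n F (2 * n + 1) = {T}) {x : ℕ} : x ∈ T.secondLeaves ↔
      ∃ a, (a, x) ∈ F ∧ Marked n a ∧ ¬ Marked n x ∧ fillCount n F a (fill n F a) = 0 := by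
  rw [mem_secondLeaves_iff (((decomposes_iff hn).2 ⟨hF, hT⟩).isLabelled hn).nodup]
  simp only [edge_succ_and_noChild_iff hn hF hT (k := 0)]
  constructor
  · rintro ⟨p, a, h, ha, hx, rfl, h₀⟩
    exact ⟨a, h, ha, hx, h₀⟩
  · rintro ⟨a, h, ha, hx, h₀⟩
    exact ⟨_, a, h, ha, hx, rfl, h₀⟩

theorem mem_youngerLeaves_iff_fill (hn : 1 ≤ n) (hF : IsMatchSet n F)
    (hT : state n F (2 * n + 1) = {T}) {x : ℕ} : x ∈ T.youngerLeaves ↔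
      ∃ a, (a, x) ∈ F ∧ Marked n a ∧ ¬ Marked n x ∧ fillCount n F a (fill n F a) ≠ 0 := by
  rw [mem_youngerLeaves_iff (((decomposes_iff hn).2 ⟨hF, hT⟩).isLabelled hn).nodup]
  constructor
  · rintro ⟨p, k, hk, h⟩
    obtain ⟨k, rfl⟩ := Nat.exists_eq_add_of_le' hk
    obtain ⟨a, hm, ha, hx, rfl, h₀⟩ :=
      (edge_succ_and_noChild_iff hn hF hT (k := k + 1)).1 h
    exact ⟨a, hm, ha, hx, by omega⟩
  · rintro ⟨a, h, ha, hx, h₀⟩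
    exact ⟨_, _, by omega, (edge_succ_and_noChild_iff hn hF hT).2 ⟨a, h, ha, hx, rfl, rfl⟩⟩

theorem mem_elderTwinLeaves_iff_fill (hn : 1 ≤ n) (hF : IsMatchSet n F)
    (hT : state n F (2 * n + 1) = {T}) (h₃ : ∀ m ∈ F, ¬ TypeIII n m) {x : ℕ} :
    x ∈ T.elderTwinLeaves ↔ ∃ a l, (a, l) ∈ F ∧ Marked n a ∧ ¬ Marked n l ∧
      (fill n F a, x) ∈ F ∧ TypeI n (fill n F a, x) ∧ fillCount n F a (fill n F a) = 0 := by
  rw [mem_elderTwinLeaves_iff (((decomposes_iff hn).2 ⟨hF, hT⟩).isLabelled hn).nodup]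
  constructor
  · rintro ⟨p, y, h₁, hx, h₂⟩
    obtain ⟨hm, hI⟩ := (edge_zero_and_noChild_iff hn hF hT h₃).1 ⟨h₁, hx⟩
    obtain ⟨a, h, ha, hy, rfl, h₀⟩ := (edge_succ_and_noChild_iff hn hF hT (k := 0)).1 h₂
    exact ⟨a, y, h, ha, hy, hm, hI, h₀⟩
  · rintro ⟨a, l, h, ha, hl, hm, hI, h₀⟩
    obtain ⟨h₁, hx⟩ := (edge_zero_and_noChild_iff hn hF hT h₃).2 ⟨hm, hI⟩
    exact ⟨_, l, h₁, hx,
      (edge_succ_and_noChild_iff hn hF hT (k := 0)).2 ⟨a, h, ha, hl, rfl, h₀⟩⟩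

theorem mem_elderNonTwinLeaves_iff_fill (hn : 1 ≤ n) (hF : IsMatchSet n F)
    (hT : state n F (2 * n + 1) = {T}) (h₃ : ∀ m ∈ F, ¬ TypeIII n m) {x : ℕ} :
    x ∈ T.elderNonTwinLeaves ↔ ∃ a l, (a, l) ∈ F ∧ Marked n a ∧ Marked n l ∧
      (fill n F a, x) ∈ F ∧ TypeI n (fill n F a, x) ∧ fillCount n F a (fill n F a) = 0 := by
  rw [mem_elderNonTwinLeaves_iff (((decomposes_iff hn).2 ⟨hF, hT⟩).isLabelled hn).nodup]
  constructor
  · rintro ⟨p, y, h₁, hx, h₂, hy⟩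
    obtain ⟨hm, hI⟩ := (edge_zero_and_noChild_iff hn hF hT h₃).1 ⟨h₁, hx⟩
    obtain ⟨a, l, h, ha, rfl, h₀, rfl⟩ := (edge_succ_iff hn hF hT (k := 0)).1 h₂
    rw [noChild_sub_iff hn hF hT h, not_not] at hy
    exact ⟨a, l, h, ha, hy, hm, hI, h₀⟩
  · rintro ⟨a, l, h, ha, hl, hm, hI, h₀⟩
    obtain ⟨h₁, hx⟩ := (edge_zero_and_noChild_iff hn hF hT h₃).2 ⟨hm, hI⟩
    refine ⟨_, _, h₁, hx, (edge_succ_iff hn hF hT (k := 0)).2 ⟨a, l, h, ha, rfl, h₀, rfl⟩, ?_⟩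
    rw [noChild_sub_iff hn hF hT h, not_not]
    exact hl

theorem mem_singletonLeaves_iff_fill (hn : 2 ≤ n) (hF : IsMatchSet n F)
    (hT : state n F (2 * n + 1) = {T}) (h₃ : ∀ m ∈ F, ¬ TypeIII n m) {x : ℕ} :
    x ∈ T.singletonLeaves ↔ ∃ r a, (r, a) ∈ F ∧ Marked n r ∧ Marked n a ∧
      (fill n F a, x) ∈ F ∧ TypeI n (fill n F a, x) ∧ fillCount n F a (fill n F a) = 0 := by
  have hn₁ : 1 ≤ n := by omega
  have hlab := ((decomposes_iff hn₁).2 ⟨hF, hT⟩).isLabelled hn₁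
  have hnd := hlab.nodup
  rw [mem_singletonLeaves_iff hnd]
  constructor
  · rintro ⟨p, h₁, hx, h₂⟩
    obtain ⟨hm, hI⟩ := (edge_zero_and_noChild_iff hn₁ hF hT h₃).1 ⟨h₁, hx⟩
    have hroot : p ≠ T.root := by
      -- Otherwise `p` and `x` would be the only vertices.
      intro hp
      have hall : ∀ z ∈ T.labels, z = p ∨ z = x := by
        refine edge_induction (Or.inl hp.symm) fun q k c he hq => ?_
        rcases hq with rfl | rfl
        · rcases Nat.eq_zero_or_pos k with rfl | hk
          · exact Or.inr (he.unique hnd h₁)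
          · exact (h₂ (he.of_le hk)).elim
        · exact (hx (he.of_le (Nat.zero_le _))).elim
      have e₁ := hall 1 (hlab.mem_labels_iff.2 (by omega))
      have e₂ := hall 2 (hlab.mem_labels_iff.2 (by omega))
      have e₃ := hall 3 (hlab.mem_labels_iff.2 (by omega))
      omega
    obtain ⟨q, k, he⟩ := (eq_root_or_exists_edge h₁.left_mem).resolve_left hroot
    obtain ⟨⟨r, a⟩, hra, -, -, h₄⟩ := (edge_iff hn₁ hF hT).1 he
    have hb := (hF.mem_bounds hra).2
    have ha : Marked n a := by
      by_contra ha
      refine (noChild_sub_iff hn₁ hF hT hra).2 ha ⟨x, ?_⟩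
      rwa [← h₄]
    have hr : Marked n r := by
      by_contra hr
      exact h₃ _ hra ⟨hr, ha⟩
    simp only at h₄ hb
    rw [sub_of_lt ha (by omega)] at h₄
    subst h₄
    refine ⟨r, a, hra, hr, ha, hm, hI, ?_⟩
    by_contra h₀
    exact h₂ (exists_edge_fill hn₁ hF hT ha hb.2 (Nat.one_le_iff_ne_zero.2 h₀))
  · rintro ⟨r, a, h, hr, ha, hm, hI, h₀⟩
    obtain ⟨h₁, hx⟩ := (edge_zero_and_noChild_iff hn₁ hF hT h₃).2 ⟨hm, hI⟩
    refine ⟨_, h₁, hx, ?_⟩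
    rintro ⟨c, hc⟩
    exact not_edge_fill_snd hn₁ hF hT h ha (by simp only [h₀]; omega) hc

/-- A tree of the run whose root has the match `(i, x)` and has not been merged yet is still this
match. -/
theorem eq_matchTree (hn : 1 ≤ n) (hF : IsMatchSet n F) (hj : n + 2 ≤ j) (hj' : j ≤ 2 * n + 1)
    {i x : ℕ} (hm : (i, x) ∈ F) (hI : TypeI n (i, x)) {V : PlaneTree} (hV : V ∈ state n F j)
    (hr : V.root = i) (h₀ : fillCount n F j i = 0) : V = matchTree (i, x) := by
  have hst := isState_state hn hF hj hj'
  have hnd := hst.nodup hj hV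
  obtain ⟨hi, hx⟩ := hI
  have hl := children_length_eq hn hF hj hj' hV (hr ▸ hi)
  rw [hr, h₀] at hl
  obtain ⟨t, ht⟩ := List.length_eq_one_iff.1 hl
  obtain ⟨a, cs⟩ := V
  simp only [root_node, children_node] at hr ht
  subst hr ht
  have he : EdgeIn (state n F j) a 0 x :=
    (edgeIn_state_iff hn hF hj hj').2
      ⟨_, hm, (sub_of_le (not_lt.1 hi)).symm, (idx_of_le (not_lt.1 hi)).symm,
        (sub_of_le (not_lt.1 hx)).symm⟩
  obtain ⟨W, hW, he⟩ := he
  obtain rfl := hst.eq_of_mem hj hW hV he.left_mem (root_mem_labels _)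
  obtain ⟨u, hu, hux⟩ := ((IsSubtree.refl (node a [t])).edge_iff hnd).1 he
  simp only [List.getElem?_cons_zero, Option.some.injEq] at hu
  subst hu
  have hsub : IsSubtree t (node a [t]) := .child t t a _ (List.mem_singleton_self t) (.refl t)
  have hno : t.children = [] := by
    rw [hsub.children_eq_nil_iff hnd, hux]
    rintro ⟨c, hc⟩
    obtain ⟨T, hT⟩ := exists_state_eq_singleton hn hF
    obtain ⟨d, hd⟩ := edgeIn_state_mono hn hF hj hj' le_rfl ⟨_, hW, hc⟩ (not_lt.1 hx)
    rw [hT] at hd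
    obtain ⟨W, rfl, hd⟩ := hd
    exact not_edge_snd hn hF hT hm hd
  rw [matchTree, eq_leaf_iff.2 ⟨hux, hno⟩]

/-- At the first selection of the root `fill n F j` of a match of type i, the selected tree is this
match. -/
theorem round_matchTree (hn : 1 ≤ n) (hF : IsMatchSet n F) {x : ℕ} (hj : n + 2 ≤ j)
    (hj' : j ≤ 2 * n) (hm : (fill n F j, x) ∈ F) (hI : TypeI n (fill n F j, x))
    (h₀ : fillCount n F j (fill n F j) = 0) :
    ∃ U, Selects n (state n F j) (matchTree (fill n F j, x)) U j := by
  obtain ⟨V, U, hs, hf, -⟩ := exists_round hn hF hj hj'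
  have := eq_matchTree hn hF hj (by omega) hm hI hs.1.1 hf.symm h₀
  rw [this] at hs
  exact ⟨U, hs⟩

/-- Conversely, if the selected tree is a match of type i, then its root is selected for the first
time. -/
theorem selects_matchTree (hn : 1 ≤ n) (hF : IsMatchSet n F) {i x k : ℕ} {S : Set PlaneTree}
    {U : PlaneTree} (hS : Reaches n F S) (hs : Selects n S (matchTree (i, x)) U k)
    (hk : k ≤ 2 * n) (hi : ¬ Marked n i) : fill n F k = i ∧ fillCount n F k i = 0 := by
  obtain ⟨j, hj, hj', rfl⟩ := (reaches_iff hn hF).1 hS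
  have hst := isState_state hn hF hj hj'
  have := hst.exists_mem_labels_iff.1 ⟨U, hs.2.1, hs.2.2.1⟩
  have hmk : n + 1 < k := hs.2.2.2.1
  obtain rfl := hst.selects_mark hj (by omega) hs
  refine ⟨fill_eq hn hF hj hk hs, ?_⟩
  have := children_length_eq hn hF hj hj' hs.1.1 hi
  simp only [matchTree, children_node, root_node, List.length_singleton] at this
  omega

theorem horizontalMergeIV_iff (hn : 1 ≤ n) (hF : IsMatchSet n F) {x : ℕ} :
    HorizontalMergeIV n F x ↔ ∃ a l, (a, l) ∈ F ∧ Marked n a ∧ Marked n l ∧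
      (fill n F a, x) ∈ F ∧ TypeI n (fill n F a, x) ∧ fillCount n F a (fill n F a) = 0 := by
  constructor
  · rintro ⟨S, U, i, j, l, hS, hs, hm, hI, hjl, hIV, -⟩
    have hb := (hF.mem_bounds hjl).1
    obtain ⟨rfl, h₀⟩ := selects_matchTree hn hF hS hs hb.2 hI.1
    exact ⟨j, l, hjl, hIV.1, hIV.2, hm, hI, h₀⟩
  · rintro ⟨a, l, hal, ha, hl, hm, hI, h₀⟩
    have hb := (hF.mem_bounds hal).1
    simp only at hb
    obtain ⟨U, hs⟩ := round_matchTree hn hF ha hb.2 hm hI h₀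
    have hst := isState_state hn hF ha (show a ≤ 2 * n + 1 by omega)
    refine ⟨_, U, _, a, l, (reaches_iff hn hF).2 ⟨a, ha, by omega, rfl⟩, hs, hm, hI, hal,
      ⟨ha, hl⟩, ?_⟩
    have he : EdgeIn (state n F a) a 0 (sub n F a l) :=
      (edgeIn_state_iff hn hF ha (by omega)).2
        ⟨_, hal, (sub_of_ge le_rfl).symm, (if_neg (by simp)).symm, rfl⟩
    obtain ⟨W, hW, he⟩ := he
    obtain rfl := hst.eq_of_mem ha hW hs.2.1 he.left_mem hs.2.2.1
    obtain ⟨cs, t, hsub, ht, -⟩ := he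
    rcases (hst.marksExposed hW).2 a cs hsub ha with rfl | h
    · simp at ht
    · exact h.1.symm

theorem verticalMergeIV_iff (hn : 1 ≤ n) (hF : IsMatchSet n F) {x : ℕ} :
    VerticalMergeIV n F x ↔ ∃ r a, (r, a) ∈ F ∧ Marked n r ∧ Marked n a ∧
      (fill n F a, x) ∈ F ∧ TypeI n (fill n F a, x) ∧ fillCount n F a (fill n F a) = 0 := by
  constructor
  · rintro ⟨S, U, i, j, r, hS, hs, hm, hI, hjr, hIV, -⟩
    have hb := (hF.mem_bounds hjr).2
    obtain ⟨rfl, h₀⟩ := selects_matchTree hn hF hS hs hb.2 hI.1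
    exact ⟨r, j, hjr, hIV.1, hIV.2, hm, hI, h₀⟩
  · rintro ⟨r, a, hra, hr, ha, hm, hI, h₀⟩
    have hb := (hF.mem_bounds hra).2
    simp only at hb
    obtain ⟨U, hs⟩ := round_matchTree hn hF ha hb.2 hm hI h₀
    have hst := isState_state hn hF ha (show a ≤ 2 * n + 1 by omega)
    have he : EdgeIn (state n F a) (sub n F a r) (idx n F a r) a :=
      (edgeIn_state_iff hn hF ha (by omega)).2 ⟨_, hra, rfl, rfl, (sub_of_ge le_rfl).symm⟩
    obtain ⟨W, hW, he⟩ := he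
    obtain rfl := hst.eq_of_mem ha hW hs.2.1 he.right_mem hs.2.2.1
    have hne : W.root ≠ a := by
      rintro rfl
      exact not_edge_root (hst.nodup ha hW) he
    exact ⟨_, W, _, a, r, (reaches_iff hn hF).2 ⟨a, ha, by omega, rfl⟩, hs, hm, hI, hra,
      ⟨hr, ha⟩, hne, ((hst.marksExposed hW).root_or_leaf hs.2.2.1 ha).resolve_left hne⟩

end FinalTree

end Chen

/-! ### Turning the matches of type iv upside down -/

namespace Chen

open PlaneTree

/-- The trees without marked vertices at the time `j`. -/
def units (n : ℕ) (F : Finset (ℕ × ℕ)) (j : ℕ) : Set PlaneTree :=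
  {V | V ∈ state n F j ∧ Unmarked n V}

section Units

variable {n j : ℕ} {F : Finset (ℕ × ℕ)}

theorem matchTree_mem_units (hn : 1 ≤ n) (hF : IsMatchSet n F) (hj : n + 2 ≤ j)
    (hj' : j ≤ 2 * n + 1) {i x : ℕ} (hm : (i, x) ∈ F) (hI : TypeI n (i, x))
    (h₀ : fillCount n F j i = 0) : matchTree (i, x) ∈ units n F j := by
  have hst := isState_state hn hF hj hj'
  have hb := (hF.mem_bounds hm).1
  obtain ⟨V, hV, hi⟩ := hst.exists_mem_labels_iff.2 (Or.inl ⟨hb.1, not_lt.1 hI.1⟩)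
  have hr : V.root = i := by
    rcases eq_root_or_exists_edge hi with h | ⟨p, k, he⟩
    · exact h.symm
    exfalso
    obtain ⟨m, hm', -, -, h₁⟩ := (edgeIn_state_iff hn hF hj hj').1 ⟨V, hV, he⟩
    rcases Nat.lt_or_ge (n + 1) m.2 with h₂ | h₂
    · rcases Nat.lt_or_ge m.2 j with h₃ | h₃
      · rw [sub_of_lt h₂ h₃] at h₁
        exact absurd (fillCount_lt h₂ h₃ h₁.symm) (by simp only [h₀]; omega)
      · rw [sub_of_ge h₃] at h₁
        exact hI.1 (h₁ ▸ h₂)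
    · rw [sub_of_le h₂] at h₁
      exact hF.fst_ne_snd hm hm' h₁
  have hVm := eq_matchTree hn hF hj hj' hm hI hV hr h₀
  rw [hVm] at hV
  refine ⟨hV, fun a ha => ?_⟩
  simp only [matchTree, labels_node, List.flatMap_cons, List.flatMap_nil, List.append_nil,
    List.mem_cons, List.not_mem_nil, or_false] at ha
  rcases ha with rfl | rfl
  · exact hI.1
  · exact hI.2

theorem exists_typeI_of_mem_units (hn : 1 ≤ n) (hF : IsMatchSet n F)
    (h₃ : ∀ m ∈ F, ¬ TypeIII n m) (hj : n + 2 ≤ j) (hj' : j ≤ 2 * n + 1) {V : PlaneTree}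
    (hV : V ∈ units n F j) : ∃ x, (V.root, x) ∈ F ∧ TypeI n (V.root, x) := by
  have hst := isState_state hn hF hj hj'
  have hu := hV.2 _ (root_mem_labels V)
  suffices h : ∃ x, (V.root, x) ∈ F by
    obtain ⟨x, hx⟩ := h
    exact ⟨x, hx, hu, fun hxm => h₃ _ hx ⟨hu, hxm⟩⟩
  have hk : 0 < V.children.length := List.length_pos_iff.2 (hst.marksExposed hV.1).1
  have he : EdgeIn (state n F j) V.root 0 V.children[0].root :=
    ⟨V, hV.1, _, V.children[0], isSubtree_root V, List.getElem?_eq_getElem hk, rfl⟩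
  obtain ⟨m, hm, h₁, -, -⟩ := (edgeIn_state_iff hn hF hj hj').1 he
  rcases Nat.lt_or_ge (n + 1) m.1 with h | h
  · rcases Nat.lt_or_ge m.1 j with h₂ | h₂
    · rw [sub_of_lt h h₂] at h₁
      rw [h₁]
      exact exists_fill_mem hn hF h (by omega)
    · rw [sub_of_ge h₂] at h₁
      exact (hu (h₁ ▸ h)).elim
  · rw [sub_of_le h] at h₁
    exact ⟨m.2, h₁ ▸ hm⟩

/-- Roots that have been selected before are smaller than the roots of the matches of type i that
have never been selected, because these were available all the time. -/
theorem lt_of_fillCount (hn : 1 ≤ n) (hF : IsMatchSet n F) (hj' : j ≤ 2 * n + 1) {i x l : ℕ}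
    (hm : (i, x) ∈ F) (hI : TypeI n (i, x)) (h₀ : fillCount n F j i = 0)
    (hl : fillCount n F j l ≠ 0) : l < i := by
  obtain ⟨k, hk⟩ := Finset.card_pos.1 (Nat.pos_of_ne_zero hl)
  rw [Finset.mem_filter, Finset.mem_Ico] at hk
  obtain ⟨⟨hk₁, hk₂⟩, rfl⟩ := hk
  have h₀' : fillCount n F k i = 0 := by
    have := fillCount_mono (n := n) hk₂.le F i
    omega
  have hmem := matchTree_mem_units hn hF hk₁ (by omega) hm hI h₀'
  obtain ⟨V, U, hs, hf, -⟩ := exists_round hn hF hk₁ (by omega)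
  have hle := hs.1.2.2 _ hmem.1 hmem.2
  rw [← hf] at hle
  refine lt_of_le_of_ne hle ?_
  rintro (rfl : fill n F k = i)
  exact hl h₀

/-- Two marked vertices of one tree belong to one match. -/
theorem mem_of_marked_of_marked (hn : 1 ≤ n) (hF : IsMatchSet n F) (hj : n + 2 ≤ j)
    (hj' : j ≤ 2 * n + 1) {V : PlaneTree} (hV : V ∈ state n F j) {a b : ℕ} (ha : a ∈ V.labels)
    (hb : b ∈ V.labels) (hma : Marked n a) (hmb : Marked n b) (hab : a ≠ b) :
    (a, b) ∈ F ∨ (b, a) ∈ F := by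
  induction j, hj using Nat.le_induction generalizing V with
  | base =>
    rw [state_start] at hV
    obtain ⟨⟨c, d⟩, hm, rfl⟩ := hV
    simp only [matchTree, labels_node, List.flatMap_cons, List.flatMap_nil, List.append_nil,
      List.mem_cons, List.not_mem_nil, or_false] at ha hb
    rcases ha with rfl | rfl <;> rcases hb with rfl | rfl
    · exact (hab rfl).elim
    · exact Or.inl hm
    · exact Or.inr hm
    · exact (hab rfl).elim
  | succ j hj ih =>
    have hst := isState_state hn hF hj (by omega)
    obtain ⟨T, U, hs, -, he⟩ := exists_round hn hF hj (by omega)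
    rw [he] at hV
    rcases hV with rfl | ⟨hV, -⟩
    · rw [mem_merge_labels (hst.nodup hj hs.2.1) ((hst.marksExposed hs.2.1).root_or_leaf
        hs.2.2.1 hs.2.2.2.1) (fun h => hs.1.2.1 _ h hs.2.2.2.1)] at ha hb
      exact ih (by omega) hs.2.1 (ha.resolve_left fun h => hs.1.2.1 _ h hma).1
        (hb.resolve_left fun h => hs.1.2.1 _ h hmb).1
    · exact ih (by omega) hV ha hb

open Classical in
/-- The round for `j` uses up an unmarked tree, and produces one exactly when the match of `j` has
no other mark left. -/
theorem ncard_units_succ (hn : 1 ≤ n) (hF : IsMatchSet n F) (hj : n + 2 ≤ j) (hj' : j ≤ 2 * n) :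
    (units n F (j + 1)).ncard + 1 = (units n F j).ncard +
      if ∃ b, j < b ∧ ((j, b) ∈ F ∨ (b, j) ∈ F) then 0 else 1 := by
  have hst := isState_state hn hF hj (by omega)
  obtain ⟨T, U, hs, -, he⟩ := exists_round hn hF hj hj'
  have hml := fun a => mem_merge_labels (T := T) (a := a) (hst.nodup hj hs.2.1)
    ((hst.marksExposed hs.2.1).root_or_leaf hs.2.2.1 hs.2.2.2.1)
    (fun h => hs.1.2.1 _ h hs.2.2.2.1)
  have hW : Unmarked n (merge j T U) ↔ ¬ ∃ b, j < b ∧ ((j, b) ∈ F ∨ (b, j) ∈ F) := by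
    constructor
    · rintro hW ⟨b, hb, hF'⟩
      have hbU : b ∈ U.labels := by
        rcases hF' with h | h
        · obtain ⟨V, hV, hE⟩ := (edgeIn_state_iff hn hF hj (by omega)).2 ⟨_, h, rfl, rfl, rfl⟩
          rw [sub_of_ge le_rfl, sub_of_ge hb.le] at hE
          obtain rfl := hst.eq_of_mem hj hV hs.2.1 hE.left_mem hs.2.2.1
          exact hE.right_mem
        · obtain ⟨V, hV, hE⟩ := (edgeIn_state_iff hn hF hj (by omega)).2 ⟨_, h, rfl, rfl, rfl⟩
          rw [sub_of_ge le_rfl, sub_of_ge hb.le] at hE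
          obtain rfl := hst.eq_of_mem hj hV hs.2.1 hE.right_mem hs.2.2.1
          exact hE.left_mem
      exact hW b ((hml b).2 (Or.inr ⟨hbU, by omega⟩)) (by unfold Marked; omega)
    · intro h b hb hmb
      obtain ⟨hbU, hbj⟩ := ((hml b).1 hb).resolve_left fun h => hs.1.2.1 _ h hmb
      have := hst.exists_mem_labels_iff.1 ⟨U, hs.2.1, hbU⟩
      unfold Marked at hmb
      exact h ⟨b, by omega, mem_of_marked_of_marked hn hF hj (by omega) hs.2.1 hs.2.2.1 hbU
        hs.2.2.2.1 hmb hbj.symm⟩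
  have hfin : (units n F j).Finite := hst.finite.subset fun V h => h.1
  have hTu : T ∈ units n F j := ⟨hs.1.1, hs.1.2.1⟩
  have hcard := Set.ncard_sdiff_singleton_add_one hTu hfin
  have hUu : ∀ V, Unmarked n V → V ≠ U := by
    rintro V hV rfl
    exact hV j hs.2.2.1 hs.2.2.2.1
  split_ifs with hex
  · have : units n F (j + 1) = units n F j \ {T} := by
      ext V
      constructor
      · rintro ⟨hV, hVu⟩
        rw [he] at hV
        rcases hV with rfl | ⟨hV, hne⟩
        · exact (hW.1 hVu hex).elim
        · exact ⟨⟨hV, hVu⟩, fun h => hne (Or.inl h)⟩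
      · rintro ⟨⟨hV, hVu⟩, hne⟩
        refine ⟨?_, hVu⟩
        rw [he]
        refine Or.inr ⟨hV, ?_⟩
        rintro (h | h)
        · exact hne h
        · exact hUu V hVu h
    rw [this, hcard, Nat.add_zero]
  · have : units n F (j + 1) = insert (merge j T U) (units n F j \ {T}) := by
      ext V
      constructor
      · rintro ⟨hV, hVu⟩
        rw [he] at hV
        rcases hV with rfl | ⟨hV, hne⟩
        · exact Or.inl rfl
        · exact Or.inr ⟨⟨hV, hVu⟩, fun h => hne (Or.inl h)⟩
      · rintro (rfl | ⟨⟨hV, hVu⟩, hne⟩)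
        · refine ⟨?_, hW.2 hex⟩
          rw [he]
          exact Or.inl rfl
        · refine ⟨?_, hVu⟩
          rw [he]
          refine Or.inr ⟨hV, ?_⟩
          rintro (h | h)
          · exact hne h
          · exact hUu V hVu h
    rw [this, Set.ncard_insert_of_notMem ?_ (hfin.subset Set.sdiff_subset), hcard]
    · rintro ⟨⟨hV, -⟩, hne⟩
      exact hne (hst.eq_of_mem hj hV hs.1.1 ((hml _).2 (Or.inl (root_mem_labels T)))
        (root_mem_labels T))

end Units

/-- Both `F` and `F'` are sets of matches without type iii, they have the same matches of type i,
and they agree up to the orientation of the matches of type iv. -/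
structure FlipRel (n : ℕ) (F F' : Finset (ℕ × ℕ)) : Prop where
  left : IsMatchSet n F
  right : IsMatchSet n F'
  left_typeIII : ∀ m ∈ F, ¬ TypeIII n m
  right_typeIII : ∀ m ∈ F', ¬ TypeIII n m
  typeI : ∀ m, TypeI n m → (m ∈ F ↔ m ∈ F')
  typeIV : ∀ a b, TypeIV n (a, b) → ((a, b) ∈ F ∨ (b, a) ∈ F ↔ (a, b) ∈ F' ∨ (b, a) ∈ F')

section FlipRel

variable {n j : ℕ} {F F' : Finset (ℕ × ℕ)}

theorem FlipRel.symm (h : FlipRel n F F') : FlipRel n F' F :=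
  ⟨h.right, h.left, h.right_typeIII, h.left_typeIII, fun m hm => (h.typeI m hm).symm,
    fun a b hab => (h.typeIV a b hab).symm⟩

/-- At the time `j` both runs have the same number of unmarked trees, and the same matches of
type i have not been selected yet. -/
def SameFresh (n : ℕ) (F F' : Finset (ℕ × ℕ)) (j : ℕ) : Prop :=
  (units n F j).ncard = (units n F' j).ncard ∧
    ∀ m ∈ F, TypeI n m → (fillCount n F j m.1 = 0 ↔ fillCount n F' j m.1 = 0)

theorem SameFresh.symm (hR : FlipRel n F F') (h : SameFresh n F F' j) : SameFresh n F' F j :=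
  ⟨h.1.symm, fun m hm hI => (h.2 m ((hR.typeI m hI).2 hm) hI).symm⟩

/-- If a match of type i is selected for the first time, then no tree that has been selected before
is available, so the unmarked trees are the matches of type i that have not been selected yet. -/
theorem SameFresh.fill_eq (hn : 1 ≤ n) (hR : FlipRel n F F') (hj : n + 2 ≤ j) (hj' : j ≤ 2 * n)
    (h : SameFresh n F F' j) (h₀ : fillCount n F j (fill n F j) = 0) :
    fill n F' j = fill n F j ∧ fillCount n F' j (fill n F j) = 0 := by
  obtain ⟨V, U, hs, hf, -⟩ := exists_round hn hR.left hj hj'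
  obtain ⟨V', U', hs', hf', -⟩ := exists_round hn hR.right hj hj'
  have hst' := isState_state hn hR.right hj (show j ≤ 2 * n + 1 by omega)
  have hVu : V ∈ units n F j := ⟨hs.1.1, hs.1.2.1⟩
  obtain ⟨x, hx, hxI⟩ :=
    exists_typeI_of_mem_units hn hR.left hR.left_typeIII hj (by omega) hVu
  rw [hf] at h₀ ⊢
  have hsub : units n F j ⊆ units n F' j := by
    intro W hW
    obtain ⟨y, hy, hyI⟩ :=
      exists_typeI_of_mem_units hn hR.left hR.left_typeIII hj (by omega) hW
    have hW₀ : fillCount n F j W.root = 0 := by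
      by_contra hne
      have h₁ := lt_of_fillCount hn hR.left (by omega) hx hxI h₀ hne
      exact absurd (hs.1.2.2 W hW.1 hW.2) (not_le.2 h₁)
    rw [eq_matchTree hn hR.left hj (by omega) hy hyI hW.1 rfl hW₀]
    exact matchTree_mem_units hn hR.right hj (by omega) ((hR.typeI _ hyI).1 hy) hyI
      ((h.2 _ hy hyI).1 hW₀)
  have heq : units n F j = units n F' j :=
    Set.eq_of_subset_of_ncard_le hsub h.1.ge (hst'.finite.subset fun _ h => h.1)
  have hVu' : V ∈ units n F' j := heq ▸ hVu
  have hV'u : V' ∈ units n F j := heq ▸ ⟨hs'.1.1, hs'.1.2.1⟩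
  refine ⟨?_, (h.2 _ hx hxI).1 h₀⟩
  rw [hf']
  exact le_antisymm (hs'.1.2.2 V hVu'.1 hVu'.2) (hs.1.2.2 V' hV'u.1 hV'u.2)

theorem FlipRel.sameFresh (hn : 1 ≤ n) (hR : FlipRel n F F') (hj : n + 2 ≤ j)
    (hj' : j ≤ 2 * n + 1) : SameFresh n F F' j := by
  classical
  induction j, hj using Nat.le_induction with
  | base =>
    refine ⟨?_, fun m _ _ => by simp [fillCount]⟩
    have key : ∀ {G G' : Finset (ℕ × ℕ)}, FlipRel n G G' →
        units n G (n + 2) ⊆ units n G' (n + 2) := by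
      intro G G' hG V hV
      have hV' := hV
      unfold units at hV ⊢
      rw [state_start] at hV ⊢
      obtain ⟨⟨⟨a, b⟩, hm, rfl⟩, hu⟩ := hV
      have hI : TypeI n (a, b) := ⟨hu a (by simp [matchTree, labels_node]),
        hu b (by simp [matchTree, labels_node])⟩
      exact ⟨⟨_, (hG.typeI _ hI).1 hm, rfl⟩, hu⟩
    rw [(key hR).antisymm (key hR.symm)]
  | succ j hj ih =>
    have ih := ih (by omega)
    constructor
    · have h₁ := ncard_units_succ hn hR.left hj (by omega)
      have h₂ := ncard_units_succ hn hR.right hj (by omega)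
      have hiff : (∃ b, j < b ∧ ((j, b) ∈ F ∨ (b, j) ∈ F)) ↔
          ∃ b, j < b ∧ ((j, b) ∈ F' ∨ (b, j) ∈ F') :=
        exists_congr fun b => and_congr_right fun hb => hR.typeIV j b
          ⟨by unfold Marked; omega, by unfold Marked; omega⟩
      simp only [hiff, ih.1] at h₁
      omega
    · intro m hm hI
      have key : ∀ {G G' : Finset (ℕ × ℕ)}, FlipRel n G G' → SameFresh n G G' j → m ∈ G →
          fillCount n G' (j + 1) m.1 = 0 → fillCount n G (j + 1) m.1 = 0 := by
        intro G G' hG hS hmG h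
        rw [fillCount_succ hj] at h ⊢
        have h₀ : fillCount n G j m.1 = 0 := (hS.2 m hmG hI).2 (by omega)
        rw [h₀, if_neg]
        intro hfill
        rw [← hfill] at h₀
        rw [if_pos ((hS.fill_eq hn hG hj (by omega) h₀).1.trans hfill)] at h
        omega
      exact ⟨key hR.symm (ih.symm hR) ((hR.typeI m hI).1 hm), key hR ih hm⟩

/-- First selections of matches of type i take place in the same rounds in both runs. -/
theorem FlipRel.fill_eq (hn : 1 ≤ n) (hR : FlipRel n F F') (hj : n + 2 ≤ j) (hj' : j ≤ 2 * n)
    (h₀ : fillCount n F j (fill n F j) = 0) :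
    fill n F' j = fill n F j ∧ fillCount n F' j (fill n F' j) = 0 := by
  obtain ⟨h₁, h₂⟩ := (hR.sameFresh hn hj (by omega)).fill_eq hn hR hj hj' h₀
  exact ⟨h₁, by rw [h₁, h₂]⟩

theorem mem_flip {a b : ℕ} :
    (a, b) ∈ flip n F ↔ if TypeIV n (a, b) then (b, a) ∈ F else (a, b) ∈ F := by
  rw [flip, Finset.mem_image]
  constructor
  · rintro ⟨⟨c, d⟩, hm, h⟩
    split_ifs at h with h₁ <;> rw [Prod.mk.injEq] at h <;> obtain ⟨rfl, rfl⟩ := h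
    · rw [if_pos h₁.symm]
      exact hm
    · rw [if_neg h₁]
      exact hm
  · split_ifs with h₁
    · exact fun h => ⟨_, h, if_pos h₁.symm⟩
    · exact fun h => ⟨_, h, if_neg h₁⟩

theorem flip_flip (n : ℕ) (F : Finset (ℕ × ℕ)) : flip n (flip n F) = F := by
  ext ⟨a, b⟩
  rw [mem_flip, mem_flip, mem_flip]
  by_cases h : TypeIV n (a, b)
  · rw [if_pos h, if_pos h.symm]
  · rw [if_neg h, if_neg h]

theorem isMatchSet_flip (hF : IsMatchSet n F) : IsMatchSet n (flip n F) := by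
  rw [IsMatchSet, flip, Finset.sum_image]
  · rw [← hF]
    refine Finset.sum_congr rfl fun m _ => ?_
    split_ifs
    · exact Multiset.pair_comm _ _
    · rfl
  · rintro ⟨a, b⟩ - ⟨c, d⟩ - h
    simp only at h
    split_ifs at h with h₁ h₂ h₂ <;> rw [Prod.mk.injEq] at h <;> obtain ⟨rfl, rfl⟩ := h
    · rfl
    · exact (h₂ h₁.symm).elim
    · exact (h₁ h₂.symm).elim
    · rfl

theorem flipRel_flip (hF : IsMatchSet n F) (h₃ : ∀ m ∈ F, ¬ TypeIII n m) :
    FlipRel n F (flip n F) where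
  left := hF
  right := isMatchSet_flip hF
  left_typeIII := h₃
  right_typeIII := by
    rintro ⟨a, b⟩ hm h
    rw [mem_flip, if_neg fun h' => h.1 h'.1] at hm
    exact h₃ _ hm h
  typeI := by
    rintro ⟨a, b⟩ h
    rw [mem_flip, if_neg fun h' => h.1 h'.1]
  typeIV := by
    intro a b h
    rw [mem_flip, mem_flip, if_pos h, if_pos h.symm, or_comm]

end FlipRel

section Leaves

variable {n : ℕ} {F : Finset (ℕ × ℕ)} {T T' : PlaneTree}

/-- The rounds with a first selection are the same in both runs. -/
theorem first_fill_iff (hn : 1 ≤ n) {F' : Finset (ℕ × ℕ)} (hR : FlipRel n F F') {j : ℕ}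
    (hj : n + 2 ≤ j) (hj' : j ≤ 2 * n) :
    fillCount n F' j (fill n F' j) = 0 ↔ fillCount n F j (fill n F j) = 0 :=
  ⟨fun h => (hR.symm.fill_eq hn hj hj' h).2, fun h => (hR.fill_eq hn hj hj' h).2⟩

/-- Turning the matches of type iv upside down preserves the round in which a match of type i is
first selected, and swaps the two ends of the match of type iv at which it is merged. -/
theorem leaves_flip (hn : 2 ≤ n) (hF : IsMatchSet n F) (h₃ : ∀ m ∈ F, ¬ TypeIII n m)
    (hT : state n F (2 * n + 1) = {T}) (hT' : state n (flip n F) (2 * n + 1) = {T'}) :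
    T'.singletonLeaves = T.elderNonTwinLeaves ∧ T'.elderTwinLeaves ⊆ T.elderTwinLeaves ∧
      T'.secondLeaves = T.secondLeaves ∧ T'.youngerLeaves = T.youngerLeaves := by
  have hn₁ : 1 ≤ n := by omega
  have hR := flipRel_flip hF h₃
  have hF' := hR.right
  have h₃' := hR.right_typeIII
  have hfirst : ∀ {a}, Marked n a → a ≤ 2 * n → ∀ x,
      ((fill n (flip n F) a, x) ∈ flip n F ∧ TypeI n (fill n (flip n F) a, x) ∧
        fillCount n (flip n F) a (fill n (flip n F) a) = 0 ↔
      (fill n F a, x) ∈ F ∧ TypeI n (fill n F a, x) ∧ fillCount n F a (fill n F a) = 0) := by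
    intro a ha ha' x
    constructor
    · rintro ⟨hm, hI, h₀⟩
      obtain ⟨h₁, h₂⟩ := hR.symm.fill_eq hn₁ ha ha' h₀
      rw [h₁] at h₂ ⊢
      exact ⟨(hR.typeI _ hI).2 hm, hI, h₂⟩
    · rintro ⟨hm, hI, h₀⟩
      obtain ⟨h₁, h₂⟩ := hR.fill_eq hn₁ ha ha' h₀
      rw [h₁] at h₂ ⊢
      exact ⟨(hR.typeI _ hI).1 hm, hI, h₂⟩
  have hii : ∀ {a b}, ¬ Marked n b → ((a, b) ∈ flip n F ↔ (a, b) ∈ F) := by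
    intro a b hb
    rw [mem_flip, if_neg fun h => hb h.2]
  refine ⟨?_, ?_, ?_, ?_⟩
  · ext x
    rw [mem_singletonLeaves_iff_fill hn hF' hT' h₃', mem_elderNonTwinLeaves_iff_fill hn₁ hF hT h₃,
      exists_comm]
    refine exists_congr fun a => exists_congr fun l => ?_
    constructor
    · rintro ⟨hm, hl, ha, h⟩
      rw [mem_flip, if_pos ⟨hl, ha⟩] at hm
      exact ⟨hm, ha, hl, (hfirst ha (hF.mem_bounds hm).1.2 x).1 h⟩
    · rintro ⟨hm, ha, hl, h⟩
      refine ⟨?_, hl, ha, (hfirst ha (hF.mem_bounds hm).1.2 x).2 h⟩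
      rwa [mem_flip, if_pos ⟨hl, ha⟩]
  · intro x
    rw [mem_elderTwinLeaves_iff_fill hn₁ hF' hT' h₃', mem_elderTwinLeaves_iff_fill hn₁ hF hT h₃]
    rintro ⟨a, l, hm, ha, hl, h⟩
    exact ⟨a, l, (hii hl).1 hm, ha, hl, (hfirst ha (hF'.mem_bounds hm).1.2 x).1 h⟩
  · ext x
    rw [mem_secondLeaves_iff_fill hn₁ hF' hT', mem_secondLeaves_iff_fill hn₁ hF hT]
    refine exists_congr fun a => ?_
    constructor
    · rintro ⟨hm, ha, hx, h⟩
      exact ⟨(hii hx).1 hm, ha, hx, (first_fill_iff hn₁ hR ha (hF'.mem_bounds hm).1.2).1 h⟩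
    · rintro ⟨hm, ha, hx, h⟩
      exact ⟨(hii hx).2 hm, ha, hx, (first_fill_iff hn₁ hR ha (hF.mem_bounds hm).1.2).2 h⟩
  · ext x
    rw [mem_youngerLeaves_iff_fill hn₁ hF' hT', mem_youngerLeaves_iff_fill hn₁ hF hT]
    refine exists_congr fun a => ?_
    constructor
    · rintro ⟨hm, ha, hx, h⟩
      exact ⟨(hii hx).1 hm, ha, hx,
        mt (first_fill_iff hn₁ hR ha (hF'.mem_bounds hm).1.2).2 h⟩
    · rintro ⟨hm, ha, hx, h⟩
      exact ⟨(hii hx).2 hm, ha, hx, mt (first_fill_iff hn₁ hR ha (hF.mem_bounds hm).1.2).1 h⟩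

end Leaves

end Chen

/-! ### The involution -/

theorem mainTheorem2 (n : ℕ) (hn : 2 ≤ n) :
    -- every tree has exactly one decomposition into matches
    (∀ T : TipAugmentedTree n, ∃! F : Finset (ℕ × ℕ), Chen.Decomposes n T.1 F) ∧
    -- the decomposition has no match of type iii, and the two kinds of leaves arise as described
    (∀ (T : TipAugmentedTree n) (F : Finset (ℕ × ℕ)), Chen.Decomposes n T.1 F →
      (∀ m ∈ F, ¬ Chen.TypeIII n m) ∧
      (∀ x : ℕ, x ∈ T.1.elderNonTwinLeaves ↔ Chen.HorizontalMergeIV n F x) ∧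
      (∀ x : ℕ, x ∈ T.1.singletonLeaves ↔ Chen.VerticalMergeIV n F x)) ∧
    -- the involution
    ∃ Ψ : TipAugmentedTree n → TipAugmentedTree n,
      Function.Involutive Ψ ∧
      -- re-merging the decomposition of `T` with all type iv matches turned upside down
      -- yields `Ψ T` and nothing else
      (∀ (T : TipAugmentedTree n) (F : Finset (ℕ × ℕ)), Chen.Decomposes n T.1 F →
        ∀ T' : PlaneTree, Chen.Decomposes n T' (Chen.flip n F) ↔ T' = (Ψ T).1) ∧
      ∀ T : TipAugmentedTree n,
        (Ψ T).1.singletonLeaves = T.1.elderNonTwinLeaves ∧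
        (Ψ T).1.elderNonTwinLeaves = T.1.singletonLeaves ∧
        (Ψ T).1.elderTwinLeaves = T.1.elderTwinLeaves ∧
        (Ψ T).1.secondLeaves = T.1.secondLeaves ∧
        (Ψ T).1.youngerLeaves = T.1.youngerLeaves := by
  have hn₁ : 1 ≤ n := by omega
  have hex : ∀ T : TipAugmentedTree n, ∃ F, Chen.Decomposes n T.1 F := fun T =>
    Chen.exists_decomposes hn₁ T.2.1
  have h₃ : ∀ (T : TipAugmentedTree n) F, Chen.Decomposes n T.1 F → ∀ m ∈ F, ¬ Chen.TypeIII n m :=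
    fun T F h => (Chen.isTipAugmented_iff hn₁ ((Chen.decomposes_iff hn₁).1 h).1
      ((Chen.decomposes_iff hn₁).1 h).2).1 T.2.2
  refine ⟨fun T => ?_, fun T F h => ?_, ?_⟩
  · obtain ⟨F, hF⟩ := hex T
    exact ⟨F, hF, fun F' hF' => hF'.unique hn₁ hF⟩
  · obtain ⟨hF, hT⟩ := (Chen.decomposes_iff hn₁).1 h
    refine ⟨h₃ T F h, fun x => ?_, fun x => ?_⟩
    · rw [Chen.mem_elderNonTwinLeaves_iff_fill hn₁ hF hT (h₃ T F h),
        Chen.horizontalMergeIV_iff hn₁ hF]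
    · rw [Chen.mem_singletonLeaves_iff_fill hn hF hT (h₃ T F h),
        Chen.verticalMergeIV_iff hn₁ hF]
  · choose D hD using hex
    have hflip : ∀ T : TipAugmentedTree n, ∃ T' : TipAugmentedTree n,
        Chen.Decomposes n T'.1 (Chen.flip n (D T)) := by
      intro T
      have hR := Chen.flipRel_flip ((Chen.decomposes_iff hn₁).1 (hD T)).1 (h₃ T _ (hD T))
      obtain ⟨T', hT'⟩ := Chen.exists_state_eq_singleton hn₁ hR.right
      have hd := (Chen.decomposes_iff hn₁).2 ⟨hR.right, hT'⟩
      exact ⟨⟨T', hd.isLabelled hn₁,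
        (Chen.isTipAugmented_iff hn₁ hR.right hT').2 hR.right_typeIII⟩, hd⟩
    choose Ψ hΨ using hflip
    have hDΨ : ∀ T, D (Ψ T) = Chen.flip n (D T) := fun T => (hD (Ψ T)).unique hn₁ (hΨ T)
    have htree : ∀ {T T' : PlaneTree} {F}, Chen.Decomposes n T F → Chen.Decomposes n T' F →
        T' = T := by
      intro T T' F h h'
      have := ((Chen.decomposes_iff hn₁).1 h').2
      rw [((Chen.decomposes_iff hn₁).1 h).2] at this
      exact (Set.singleton_injective this).symm
    have hinv : Function.Involutive Ψ := by
      intro T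
      have h := hΨ (Ψ T)
      rw [hDΨ, Chen.flip_flip] at h
      exact Subtype.ext (htree (hD T) h)
    have hleaves : ∀ T, _ := fun T => Chen.leaves_flip hn ((Chen.decomposes_iff hn₁).1 (hD T)).1
      (h₃ T _ (hD T)) ((Chen.decomposes_iff hn₁).1 (hD T)).2
      ((Chen.decomposes_iff hn₁).1 (hΨ T)).2
    refine ⟨Ψ, hinv, fun T F h T' => ?_, fun T => ?_⟩
    · obtain rfl := h.unique hn₁ (hD T)
      exact ⟨fun h' => htree (hΨ T) h', fun h' => h' ▸ hΨ T⟩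
    · have h₁ := hleaves T
      have h₂ := hleaves (Ψ T)
      rw [hinv T] at h₂
      exact ⟨h₁.1, h₂.1.symm, h₁.2.1.antisymm h₂.2.1, h₁.2.2.1, h₁.2.2.2⟩
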